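/- Let $\theta=\theta_0\in(0,1)$ be irrational with continued fraction $\theta=1/(c_0+1/(c_1+1/(c_2+\cdots)))$, $c_n\ge 1$, and let $\theta_n=1/(c_n+\theta_{n+1})$. Let the infinite dihedral group $D_\infty=\langle a,b\rangle$ act on the Cantor set $\mathcal X_\theta$ (the circle $\mathbb R/\mathbb Z$ with each point of the orbit of $0$ doubled) by the reflections $a:x\mapsto 1-x$ and $b:x\mapsto\theta-x$. *The diagram.* Let $\mathsf B$ be the Bratteli diagram with vertices $V_n=\{0,1\}$ for $n\ge 0$ and with edges $I_0,\dots,I_{c_n}$ (ending in $0\in V_{n+1}$) and $J_0,\dots,J_{c_n-1}$ (ending in $1\in V_{n+1}$) from level $n$ to level $n+1$; the edges $I_0,J_0$ start in $0\in V_n$, the others in $1\in V_n$. Let $\Omega(\mathsf B)$ be its space of infinite paths from level $0$. Encoding a point of $\mathcal X_{\theta_n}$ by the interval $I_k$ or $J_k$ of the two towers over $[0,\theta_n]$ in which it lies, followed by the code of the rescaled point of $\mathcal X_{\theta_{n+1}}$, turns the action into the following one on $\Omega(\mathsf B)$. The reflection $a$ interchanges (on the first edge, in each tower) the indices $2j$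 and $2j+1$, and $b$ interchanges $2j+1$ and $2j+2$, with trivial section (the rest of the path is unchanged), whenever both indices occur in the tower; $b$ acts on a path whose first edge is $I_0$ or $J_0$ by applying the reflection $a$ of the next level to the rest of the path (the first edge becoming the one of $I_0,J_0$ that fits); and at the last edge of a tower (where that last rule does not apply), the reflection which does not interchange the last two indices fixes this edge and acts on the rest of the path as the reflection $b$ of the next level. *The tiles.* For $v\in V_n$ the vertices of the finite tile $\mathcal T_{v,n}$ are the paths of length $n$ from level $0$ to $v$. The tiles of level $0$ are single vertices with boundary edges labelled $a$ and $b$. The tile $\mathcal T_{v,n+1}$ is the union of copies $e\,\mathcal T_{s(e),n}$ of tiles of level $n$, one for each edge $e$ ending in $v$, where boundary vertices $e\gamma$, $e'\gamma'$ are connected by an edge labelled $F\in\{a,b\}$ if $F$ has at $\gamma$ and at $\gamma'$ the same nontrivial section $t$ and $t$ interchanges $e$ and $e'$; the remaining boundary edges of the copies are the boundary edges of $\mathcal T_{v,n+1}$. Infinite tiles are the inductive limits of finite tiles along the paths in $\Omega(\mathsf B)$. A boundary point of an infinite tile is a path all of whose truncations are boundary vertices. A copy of $\mathcal T_{v,n}$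 in an infinite tile or orbital graph is a set $\{w\gamma:\gamma\in\mathcal T_{v,n}\}$ with a fixed infinite tail $w$ starting in $v$. The action is called *linearly repetitive* on infinite tiles (resp. on orbital graphs) if there is a constant $K>1$ such that for every finite tile $\mathcal T$ with more than one vertex and every vertex $\omega$ of every infinite tile (resp. orbital graph) $\Gamma$, the ball of radius $K\cdot\mathrm{Diam}(\mathcal T)$ around $\omega$ in $\Gamma$ contains a copy of $\mathcal T$. The group $D_\infty$ with this action is called *of bounded type* (with respect to the above tiles) if the above is a tile inflation process such that the numbers of boundary vertices of the finite tiles are uniformly bounded, there are only finitely many boundary points of infinite tiles, and the numbers of vertices and of edges on the levels of $\mathsf B$ are uniformly bounded, and if the labels, after extending their action at boundary points of infinite tiles, act as the homeomorphisms $a$, $b$ of $\Omega(\mathsf B)$, so that the orbital graphs are perfectly labelled. Then: 1. The action of $D_\infty$ on $\Omega(\mathsf B)$ is linearly repetitive on infinite tiles if and only if the sequence $(c_0,c_1,\dots)$ is bounded, and it is linearly repetitive on orbital graphs if and only if the sequence $(c_0,c_1,\dots)$ is bounded. 2. $D_\infty$ with its action on $\Omega(\mathsf B)$ is of bounded type if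 and only if the sequence $(c_0,c_1,\dots)$ is bounded, i.e. if and only if $\theta$ has a continued fraction of bounded type. -/

import Mathlib

/-! ### Bratteli diagrams and their path spaces -/

/-- A Bratteli diagram: finite vertex sets `V n`, finite edge sets `E n`, and surjective source and
range maps `E n → V n`, `E n → V (n + 1)`. Levels are numbered from `0`. -/
structure BratteliDiagram where
  V : ℕ → Type
  E : ℕ → Type
  src : ∀ n, E n → V n
  rng : ∀ n, E n → V (n + 1)
  finite_V : ∀ n, Finite (V n)
  finite_E : ∀ n, Finite (E n)
  src_surjective : ∀ n, Function.Surjective (src n)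
  rng_surjective : ∀ n, Function.Surjective (rng n)

namespace BratteliDiagram

/-- `B.Path n v`: the paths of length `n` that start on level `0` and end in the vertex `v` of
level `n`. A path `⟨e, γ⟩` of length `n + 1` is a last edge `e` ending in `v`, together with a path
`γ` of length `n` that ends in the source of `e`. -/
def Path (B : BratteliDiagram) : (n : ℕ) → B.V n → Type
  | 0, _ => Unit
  | n + 1, v => (e : {e : B.E n // B.rng n e = v}) × Path B n (B.src n e.1)

/-- The space `Ω(B)` of infinite paths starting on level `0`. -/
@[ext]
structure Omega (B : BratteliDiagram) : Type where
  edge : (n : ℕ) → B.E n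
  compat : ∀ n, B.rng n (edge n) = B.src (n + 1) (edge (n + 1))

/-- `Ω(B)` has the subspace topology of the product of the discrete spaces `E n`. -/
instance (B : BratteliDiagram) : TopologicalSpace B.Omega :=
  TopologicalSpace.induced (Omega.edge (B := B)) (@Pi.topologicalSpace ℕ B.E (fun _ => ⊥))

/-- The truncation of `ω` to its first `n` edges, as a path ending in `v`, where `v` is the source
of the edge of `ω` that follows. -/
def trunc (B : BratteliDiagram) (ω : B.Omega) :
    (n : ℕ) → (v : B.V n) → B.src n (ω.edge n) = v → B.Path n v
  | 0, _, _ => ()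
  | n + 1, _, h => ⟨⟨ω.edge n, (ω.compat n).trans h⟩, trunc B ω n _ rfl⟩

end BratteliDiagram

/-! ### Tile inflation processes -/

/-- The data of a tile inflation process with labels in `S`. The tiles of level `0` are single
vertices; `bdry₀ F v` says that an outgoing boundary edge with label `F` hangs at the vertex `v`.
`conn n v F x y` says that in passing from level `n` to level `n + 1` the vertices `x` and `y` of
the tile `𝒯_{v, n+1}` are connected by an arrow `x → y` labelled by `F`. -/
structure InflationData (B : BratteliDiagram) (S : Type) where
  bdry₀ : S → B.V 0 → Prop
  conn : (n : ℕ) → (v : B.V (n + 1)) → S → B.Path (n + 1) v → B.Path (n + 1) v → Prop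

namespace InflationData

variable {B : BratteliDiagram} {S : Type}

/-- There is an outgoing boundary edge labelled by `F` at the vertex `γ` of the tile `𝒯_{v,n}`.
On level `n + 1` these are the boundary edges of the copies of tiles of level `n` which have not
been used by a connector. The inverse of an outgoing boundary edge labelled by `F⁻¹` is an incoming
boundary edge labelled by `F` and conversely. -/
def HasBdryEdge (R : InflationData B S) : (n : ℕ) → (v : B.V n) → S → B.Path n v → Prop
  | 0, v, F, _ => R.bdry₀ F v
  | n + 1, v, F, x => HasBdryEdge R n _ F x.2 ∧ ¬ ∃ y, R.conn n v F x y

/-- There is an arrow labelled by `F` from the first to the second vertex in the tile `𝒯_{v,n}`: it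
is a connector, or it lies in one of the copies `e 𝒯_{s(e), n-1}` of tiles of the level before. -/
def Edge (R : InflationData B S) : (n : ℕ) → (v : B.V n) → S → B.Path n v → B.Path n v → Prop
  | 0, _, _, _, _ => False
  | n + 1, v, F, x, y => R.conn n v F x y ∨
      ∃ (e : {e : B.E n // B.rng n e = v}) (γ γ' : B.Path n (B.src n e.1)),
        x = ⟨e, γ⟩ ∧ y = ⟨e, γ'⟩ ∧ Edge R n _ F γ γ'

/-- The tile `𝒯_{v,n}` as a graph, without labels, loops, multiple edges and boundary edges; its
metric is the metric of the tile. -/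
def tileGraph (R : InflationData B S) (n : ℕ) (v : B.V n) : SimpleGraph (B.Path n v) :=
  SimpleGraph.fromRel fun x y => ∃ F, R.Edge n v F x y

/-- The laws of a tile inflation process: an arrow labelled by `F` that is drawn from `e₁γ₁` to
`e₂γ₂` joins an outgoing boundary edge of `γ₁` labelled by `F` to an incoming boundary edge of `γ₂`
labelled by `F`; arrows come in inverse pairs; the tiles are well-labelled and connected. -/
structure IsTileInflation [InvolutiveInv S] (R : InflationData B S) : Prop where
  conn_bdry : ∀ n v F x y, R.conn n v F x y →
    R.HasBdryEdge n _ F x.2 ∧ R.HasBdryEdge n _ F⁻¹ y.2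
  conn_inv : ∀ n v F x y, R.conn n v F x y → R.conn n v F⁻¹ y x
  conn_unique : ∀ n v F x y y', R.conn n v F x y → R.conn n v F x y' → y = y'
  connected : ∀ n v, (R.tileGraph n v).Connected

/-- A boundary vertex of a finite tile. -/
def IsBdryVertex (R : InflationData B S) (n : ℕ) (v : B.V n) (γ : B.Path n v) : Prop :=
  ∃ F, R.HasBdryEdge n v F γ

/-- A boundary point of an infinite tile: all its truncations are boundary vertices. -/
def IsBdryPoint (R : InflationData B S) (ω : B.Omega) : Prop :=
  ∀ n, R.IsBdryVertex n _ (B.trunc ω n _ rfl)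

/-- Infinite tiles are inductive limits of finite tiles: there is an arrow labelled by `F` from `ω`
to `ω'` if `ω` and `ω'` agree from some edge on and the initial parts before that edge are joined
by an arrow labelled by `F` in a finite tile. -/
def InfEdge (R : InflationData B S) (F : S) (ω ω' : B.Omega) : Prop :=
  ∃ (n : ℕ) (v : B.V n) (h : B.src n (ω.edge n) = v) (h' : B.src n (ω'.edge n) = v),
    (∀ m, n ≤ m → ω.edge m = ω'.edge m) ∧ R.Edge n v F (B.trunc ω n v h) (B.trunc ω' n v h')

/-- The graph on `Ω(B)` whose connected components are the infinite tiles. -/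
def infTileGraph (R : InflationData B S) : SimpleGraph B.Omega :=
  SimpleGraph.fromRel fun ω ω' => ∃ F, R.InfEdge F ω ω'

/-- Let the connected components of the graph `G` on `Ω(B)` be the infinite tiles, or the orbital
graphs. All finite tiles are linearly repetitive on all of them: there is `K > 1` such that for
every finite tile `𝒯_{v,n}` (with more than one vertex, so that the diameter `r` is not `0`) and
every `ω ∈ Ω(B)` the ball of radius `K r` around `ω` in its component contains a copy of `𝒯_{v,n}`.
A copy of `𝒯_{v,n}` is given by a tail `… e_{n+1} e_n` with `s(e_n) = v` (here the tail of `ζ`) and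
consists of all `… e_{n+1} e_n γ` for vertices `γ` of `𝒯_{v,n}`. -/
def LinearlyRepetitiveOn (R : InflationData B S) (G : SimpleGraph B.Omega) : Prop :=
  ∃ K : ℝ, 1 < K ∧ ∀ (n : ℕ) (v : B.V n), Nontrivial (B.Path n v) → ∀ ω : B.Omega,
    ∃ ζ : B.Omega, B.src n (ζ.edge n) = v ∧
      ∀ ζ' : B.Omega, (∀ m, n ≤ m → ζ'.edge m = ζ.edge m) →
        G.Reachable ω ζ' ∧ (G.dist ω ζ' : ℝ) ≤ K * ((R.tileGraph n v).diam : ℝ)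

/-- Tile inflation processes of bounded type: the numbers of boundary vertices of the finite tiles
are uniformly bounded, there are only finitely many boundary points of infinite tiles, and the
numbers of vertices and edges on the levels of `B` are uniformly bounded. -/
def IsBoundedType (R : InflationData B S) : Prop :=
  (∃ N : ℕ, ∀ n v, {γ : B.Path n v | R.IsBdryVertex n v γ}.encard ≤ N) ∧
  {ω : B.Omega | R.IsBdryPoint ω}.Finite ∧
  ∃ N : ℕ, ∀ n, Nat.card (B.V n) ≤ N ∧ Nat.card (B.E n) ≤ N

/-- The bijections `act F`, `F ∈ S`, of `Ω(B)` are homeomorphisms which extend the partial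
transformations defined by the labels on the infinite tiles, and they extend them at boundary
points only. (As each `act F` is a bijection, the orbital graphs are then perfectly labelled.) -/
def ExtendsTo [InvolutiveInv S] (R : InflationData B S) (act : S → Equiv.Perm B.Omega) : Prop :=
  (∀ F, Continuous (act F)) ∧ (∀ F, act F⁻¹ = (act F)⁻¹) ∧
  (∀ F ω ω', R.InfEdge F ω ω' → act F ω = ω') ∧
  ∀ F ω, (¬ ∃ ω', R.InfEdge F ω ω') → ∀ n, R.HasBdryEdge n _ F (B.trunc ω n _ rfl)

/-- The group generated by the transformations `act F`, `F ∈ S`, is a group of bounded type with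
respect to the data `R`: they are a tile inflation process of bounded type with finite labelling
set, and after an extension at boundary points of infinite tiles the labels act by `act`, with
perfectly labelled orbital graphs. -/
def IsGroupOfBoundedType [InvolutiveInv S] (R : InflationData B S)
    (act : S → Equiv.Perm B.Omega) : Prop :=
  Finite S ∧ R.IsTileInflation ∧ R.IsBoundedType ∧ R.ExtendsTo act

end InflationData

/-- The graph on `Ω(B)` whose connected components are the orbital graphs of the group generated by
the transformations `act F`, `F ∈ S`. -/
def orbitalGraph {B : BratteliDiagram} {S : Type} (act : S → Equiv.Perm B.Omega) :
    SimpleGraph B.Omega :=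
  SimpleGraph.fromRel fun ω ω' => ∃ F, act F ω = ω'

/-! ### The infinite dihedral group of a continued fraction

Let `θ = θ₀ = 1 / (c₀ + θ₁)`, `θ₁ = 1 / (c₁ + θ₂)`, ... and let `a⁽ⁿ⁾`, `b⁽ⁿ⁾` be the reflections
`x ↦ 1 - x` and `x ↦ θₙ - x` of the circle, lifted to the Cantor set `𝒳_{θₙ}`. With `c = cₙ`, the
interval `[0, θₙ]` is cut into `I₀ = [0, 1 - c θₙ]` and `J₀ = [1 - c θₙ, θₙ]`, and the circle is cut
into the two towers

  `I₀ -a- I₁ -b- I₂ -a- ... I_c`  and  `J₀ -a- J₁ -b- J₂ -a- ... J_{c-1}`,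

where consecutive intervals are interchanged by `a⁽ⁿ⁾`, `b⁽ⁿ⁾` alternatingly. A point of `𝒳_{θₙ}` is
encoded by the interval in which it lies, and the point `x / θₙ` of `𝒳_{θₙ₊₁}`, where `x ∈ [0, θₙ]`
is its image in the bottom interval under the moves in the tower. So the point with the interval of index
`2j` is `j θₙ + x`, and the point with the interval of index `2j + 1` is `1 - j θₙ - x`. -/

/-- The edges of the diagram between two consecutive levels: `inl k` is the interval `I_k`, for
`0 ≤ k ≤ c`, and `inr k` is the interval `J_k`, for `0 ≤ k ≤ c - 1`. -/
abbrev DihEdge (c : ℕ) : Type := Fin (c + 1) ⊕ Fin c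

namespace DihEdge

/-- The index `k` of the interval `I_k` or `J_k`, its height in its tower. -/
def idx {c : ℕ} : DihEdge c → ℕ
  | Sum.inl k => k
  | Sum.inr k => k

/-- The source: the intervals `I₀`, `J₀`, which lie in `[0, θ]`, start in the vertex `0`, the others,
which lie in `[θ, 1]`, start in the vertex `1`. -/
def src {c : ℕ} (e : DihEdge c) : Fin 2 := if e.idx = 0 then 0 else 1

/-- The range: `I_k` belongs to the tower `0` and `J_k` belongs to the tower `1`. -/
def rng {c : ℕ} : DihEdge c → Fin 2
  | Sum.inl _ => 0
  | Sum.inr _ => 1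

/-- `I_c` and `J_{c-1}` are the last intervals of their towers. -/
def IsTop {c : ℕ} : DihEdge c → Prop
  | Sum.inl k => (k : ℕ) = c
  | Sum.inr k => (k : ℕ) + 1 = c

instance {c : ℕ} : DecidablePred (IsTop (c := c))
  | Sum.inl k => inferInstanceAs (Decidable ((k : ℕ) = c))
  | Sum.inr k => inferInstanceAs (Decidable ((k : ℕ) + 1 = c))

end DihEdge

/-- The Bratteli diagram of the sequence `c₀, c₁, …`: two vertices `0`, `1` on each level; the
vertex `0` is connected to `0` and `1` on the next level by one edge each, and the vertex `1` is
connected to `0` by `cₙ` edges and to `1` by `cₙ - 1` edges. -/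
def dihDiagram (c : ℕ → ℕ+) : BratteliDiagram where
  V _ := Fin 2
  E n := DihEdge (c n)
  src _ := DihEdge.src
  rng _ := DihEdge.rng
  finite_V _ := inferInstance
  finite_E _ := inferInstance
  src_surjective n := by
    intro v
    have hc := (c n).pos
    fin_cases v
    · exact ⟨Sum.inl ⟨0, by omega⟩, by simp [DihEdge.src, DihEdge.idx]⟩
    · exact ⟨Sum.inl ⟨1, by omega⟩, by simp [DihEdge.src, DihEdge.idx]⟩
  rng_surjective n := by
    intro v
    have hc := (c n).pos
    fin_cases v
    · exact ⟨Sum.inl ⟨0, by omega⟩, rfl⟩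
    · exact ⟨Sum.inr ⟨0, hc⟩, rfl⟩

/-- The labels: the two generators, which are equal to their inverses. -/
inductive DihLabel : Type
  | a
  | b

instance : InvolutiveInv DihLabel where
  inv F := F
  inv_inv _ := rfl

namespace DihLabel

/-- The index of the interval into which the reflection maps (the part in question of) an interval:
`a` interchanges the indices `2j` and `2j + 1`, and `b` interchanges `2j + 1` and `2j + 2`, as long
as both of them occur in the tower; otherwise the index stays. -/
def outIdx {c : ℕ} : DihLabel → DihEdge c → ℕ
  | a, e => if e.idx % 2 = 1 then e.idx - 1 else if e.IsTop then e.idx else e.idx + 1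
  | b, e => if e.idx = 0 then 0
      else if e.idx % 2 = 0 then e.idx - 1 else if e.IsTop then e.idx else e.idx + 1

/-- The section at an edge, as a reflection on the next level; `none` is the trivial section.
The section of `b` at `I₀` and `J₀` is `a`, because `x ↦ θₙ - x` on `[0, θₙ]` is rescaled to
`x ↦ 1 - x`. The section at the top of a tower of the reflection that does not interchange the last
two intervals is `b`. The other sections are trivial. -/
def next {c : ℕ} : DihLabel → DihEdge c → Option DihLabel
  | a, e => if e.idx % 2 = 1 then none else if e.IsTop then some b else none
  | b, e => if e.idx = 0 then some a
      else if e.idx % 2 = 0 then none else if e.IsTop then some b else none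

end DihLabel

/-- The section of the generator `F` at the first `n` edges of the path `f`. -/
def dihState {c : ℕ → ℕ+} (F : DihLabel) (f : (n : ℕ) → DihEdge (c n)) : ℕ → Option DihLabel
  | 0 => some F
  | n + 1 => (dihState F f n).bind fun t => t.next (f n)

/-- The index of the image of the edge `e` under a possibly trivial section. -/
def dihOut {c : ℕ} (s : Option DihLabel) (e : DihEdge c) : ℕ :=
  match s with
  | none => e.idx
  | some t => t.outIdx e

namespace DihEdge

theorem idx_add_rng_le {c : ℕ} (e : DihEdge c) : e.idx + (e.rng : ℕ) ≤ c := by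
  rcases e with k | k
  · simpa [idx, rng] using Nat.lt_succ_iff.1 k.2
  · simp [idx, rng]

theorem isTop_iff {c : ℕ} (e : DihEdge c) : e.IsTop ↔ e.idx + (e.rng : ℕ) = c := by
  rcases e with k | k <;> simp [idx, rng, IsTop]

theorem ext_idx_rng {c : ℕ} {e e' : DihEdge c} (h : e.idx = e'.idx) (h' : e.rng = e'.rng) :
    e = e' := by
  rcases e with k | k <;> rcases e' with l | l <;> simp_all [idx, rng, Fin.ext_iff]

theorem rng_le_one {c : ℕ} (e : DihEdge c) : (e.rng : ℕ) ≤ 1 := by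
  rcases e with k | k <;> simp [rng]

theorem src_val {c : ℕ} (e : DihEdge c) : (e.src : ℕ) = if e.idx = 0 then 0 else 1 := by
  unfold src; split_ifs <;> rfl

end DihEdge

theorem DihLabel.outIdx_b_eq_zero {c : ℕ} (e : DihEdge c) :
    DihLabel.b.outIdx e = 0 ↔ e.idx = 0 := by
  simp only [DihLabel.outIdx]
  grind

theorem dihOut_bound {c c' : ℕ} (hc : 0 < c) (s : Option DihLabel) (e : DihEdge c)
    (e' : DihEdge c') (h : e.rng = e'.src) :
    dihOut s e + (if dihOut (s.bind fun t => t.next e) e' = 0 then 0 else 1) ≤ c := by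
  have h1 := e.idx_add_rng_le
  have h2 := e'.src_val
  rw [← h] at h2
  have h3 := e.isTop_iff
  have h4 := e.rng_le_one
  have h5 := DihLabel.outIdx_b_eq_zero e'
  simp only [DihLabel.outIdx] at h5
  rcases s with _ | _ | _
  · simp only [Option.bind_none, dihOut]
    rw [h2] at h1
    exact h1
  · simp only [Option.bind_some, DihLabel.next, DihLabel.outIdx, dihOut]
    by_cases ho : e.idx % 2 = 1
    · simp only [ho, if_true]
      split_ifs <;> omega
    · by_cases ht : e.IsTop
      · simp only [ho, ht, if_true, if_false, h5]
        rw [h2] at h1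
        exact h1
      · simp only [ho, ht, if_false]
        rw [h3] at ht
        split_ifs at h2 ⊢ <;> omega
  · simp only [Option.bind_some, DihLabel.next, DihLabel.outIdx, dihOut]
    by_cases hz : e.idx = 0
    · simp only [hz, if_true]
      split_ifs <;> omega
    · by_cases ho : e.idx % 2 = 0
      · simp only [hz, ho, if_true, if_false]
        split_ifs <;> omega
      · by_cases ht : e.IsTop
        · simp only [hz, ho, ht, if_true, if_false, h5]
          rw [h2] at h1
          exact h1
        · simp only [hz, ho, ht, if_false]
          rw [h3] at ht
          split_ifs at h2 ⊢ <;> omega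

/-- If the image `g` of the edge `e` under the section `s` has the index and the range that it must
have, then `s` maps `g` back to `e`, with the same section. -/
theorem dihOut_dihOut {c c' : ℕ} (s : Option DihLabel) (e g : DihEdge c)
    (e' : DihEdge c') (h : e.rng = e'.src) (hi : g.idx = dihOut s e)
    (hr : (g.rng : ℕ) = if dihOut (s.bind fun t => t.next e) e' = 0 then 0 else 1) :
    dihOut s g = e.idx ∧ (s.bind fun t => t.next g) = s.bind fun t => t.next e := by
  have h1 := e.idx_add_rng_le
  have h2 := e'.src_val
  rw [← h] at h2
  have h3 := e.isTop_iff
  have h5 := DihLabel.outIdx_b_eq_zero e'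
  simp only [DihLabel.outIdx] at h5
  have g3 := g.isTop_iff
  rcases s with _ | _ | _
  · simpa [dihOut] using hi
  · simp only [Option.bind_some, DihLabel.next, DihLabel.outIdx, dihOut] at hi hr ⊢
    by_cases ho : e.idx % 2 = 1
    · simp only [ho, if_true] at hi hr ⊢
      rw [← h2] at hr
      have q1 : ¬ g.idx % 2 = 1 := by omega
      have q2 : ¬ g.IsTop := by rw [g3]; omega
      simp only [q1, q2, if_false]
      exact ⟨by omega, trivial⟩
    · by_cases ht : e.IsTop
      · simp only [ho, ht, if_true, if_false, h5] at hi hr ⊢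
        rw [← h2] at hr
        have q1 : ¬ g.idx % 2 = 1 := by omega
        have q2 : g.IsTop := by rw [g3, hi, hr, ← h3]; exact ht
        simp only [q1, q2, if_true, if_false]
        exact ⟨hi, trivial⟩
      · simp only [ho, ht, if_false] at hi hr ⊢
        have q1 : g.idx % 2 = 1 := by omega
        simp only [q1, if_true]
        exact ⟨by omega, trivial⟩
  · simp only [Option.bind_some, DihLabel.next, DihLabel.outIdx, dihOut] at hi hr ⊢
    by_cases hz : e.idx = 0
    · simp only [hz, if_true] at hi ⊢
      simp [hi]
    · by_cases ho : e.idx % 2 = 0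
      · simp only [hz, ho, if_true, if_false] at hi hr ⊢
        rw [← h2] at hr
        have q0 : ¬ g.idx = 0 := by omega
        have q1 : ¬ g.idx % 2 = 0 := by omega
        have q2 : ¬ g.IsTop := by rw [g3]; omega
        simp only [q0, q1, q2, if_false]
        exact ⟨by omega, trivial⟩
      · by_cases ht : e.IsTop
        · simp only [hz, ho, ht, if_true, if_false, h5] at hi hr ⊢
          rw [← h2] at hr
          have q0 : ¬ g.idx = 0 := by omega
          have q1 : ¬ g.idx % 2 = 0 := by omega
          have q2 : g.IsTop := by rw [g3, hi, hr, ← h3]; exact ht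
          simp only [q0, q1, q2, if_true, if_false]
          exact ⟨hi, trivial⟩
        · simp only [hz, ho, ht, if_false] at hi hr ⊢
          have q0 : ¬ g.idx = 0 := by omega
          have q1 : g.idx % 2 = 0 := by omega
          simp only [q0, q1, if_true, if_false]
          exact ⟨by omega, trivial⟩

/-- The `n`-th edge of the image of `ω` under `F`: its index is given by `dihOut`, and it ends in the
source of the next edge of the image. -/
def dihImage {c : ℕ → ℕ+} (F : DihLabel) (f : (n : ℕ) → DihEdge (c n))
    (hf : ∀ n, (f n).rng = (f (n + 1)).src) (n : ℕ) : DihEdge (c n) :=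
  if h : dihOut (dihState F f (n + 1)) (f (n + 1)) = 0 then
    Sum.inl ⟨dihOut (dihState F f n) (f n), by
      have := dihOut_bound (c n).pos (dihState F f n) (f n) (f (n + 1)) (hf n)
      omega⟩
  else
    Sum.inr ⟨dihOut (dihState F f n) (f n), by
      have := dihOut_bound (c n).pos (dihState F f n) (f n) (f (n + 1)) (hf n)
      change dihOut (dihState F f n) (f n) +
        (if dihOut (dihState F f (n + 1)) (f (n + 1)) = 0 then 0 else 1) ≤ _ at this
      rw [if_neg h] at this
      omega⟩

section

variable {c : ℕ → ℕ+} (F : DihLabel) (f : (n : ℕ) → DihEdge (c n))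
  (hf : ∀ n, (f n).rng = (f (n + 1)).src)

theorem idx_dihImage (n : ℕ) : (dihImage F f hf n).idx = dihOut (dihState F f n) (f n) := by
  unfold dihImage; split_ifs <;> rfl

theorem rng_dihImage (n : ℕ) : (dihImage F f hf n).rng =
    if dihOut (dihState F f (n + 1)) (f (n + 1)) = 0 then 0 else 1 := by
  unfold dihImage; split_ifs <;> rfl

theorem dihImage_compat (n : ℕ) :
    (dihImage F f hf n).rng = (dihImage F f hf (n + 1)).src := by
  rw [rng_dihImage, DihEdge.src, idx_dihImage]

theorem dihImage_step (n : ℕ)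
    (h : dihState F (dihImage F f hf) n = dihState F f n) :
    dihOut (dihState F f n) (dihImage F f hf n) = (f n).idx ∧
      dihState F (dihImage F f hf) (n + 1) = dihState F f (n + 1) := by
  have key := dihOut_dihOut (dihState F f n) (f n) (dihImage F f hf n) (f (n + 1)) (hf n)
    (idx_dihImage F f hf n) (by rw [rng_dihImage, dihState]; split_ifs <;> rfl)
  exact ⟨key.1, by rw [dihState, h, key.2, dihState]⟩

theorem dihState_dihImage (n : ℕ) : dihState F (dihImage F f hf) n = dihState F f n := by
  induction n with
  | zero => rfl
  | succ k ih => exact (dihImage_step F f hf k ih).2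

theorem dihImage_dihImage :
    dihImage F (dihImage F f hf) (dihImage_compat F f hf) = f := by
  have hidx : ∀ m, dihOut (dihState F (dihImage F f hf) m) (dihImage F f hf m) = (f m).idx := by
    intro m
    rw [dihState_dihImage]
    exact (dihImage_step F f hf m (dihState_dihImage F f hf m)).1
  funext n
  apply DihEdge.ext_idx_rng
  · rw [idx_dihImage, hidx]
  · rw [rng_dihImage, hidx, hf n, DihEdge.src]

end

/-- The transformation of `Ω(B)` defined by the generator `F`. -/
def dihMap (c : ℕ → ℕ+) (F : DihLabel) (ω : (dihDiagram c).Omega) : (dihDiagram c).Omega where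
  edge := dihImage F ω.edge ω.compat
  compat := dihImage_compat F ω.edge ω.compat

theorem dihMap_dihMap (c : ℕ → ℕ+) (F : DihLabel) (ω : (dihDiagram c).Omega) :
    dihMap c F (dihMap c F ω) = ω :=
  BratteliDiagram.Omega.ext (dihImage_dihImage F ω.edge ω.compat)

/-- The action of the generators `a`, `b` of the infinite dihedral group on `Ω(B)`. -/
def dihAct (c : ℕ → ℕ+) (F : DihLabel) : Equiv.Perm (dihDiagram c).Omega where
  toFun := dihMap c F
  invFun := dihMap c F
  left_inv := dihMap_dihMap c F
  right_inv := dihMap_dihMap c F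

/-! ### The tile inflation process of the infinite dihedral group -/

/-- The section of the generator `F` at the finite path `γ`. -/
def dihSection (c : ℕ → ℕ+) (F : DihLabel) :
    (n : ℕ) → (v : (dihDiagram c).V n) → (dihDiagram c).Path n v → Option DihLabel
  | 0, _, _ => some F
  | n + 1, _, ⟨e, γ⟩ => (dihSection c F n _ γ).bind fun t => t.next (c := c n) e.1

/-- On the tower of the edges that end in a given vertex the reflection `t` interchanges the edges
of index `k` and `k + 1`, for even `k` if `t = a` and for odd `k` if `t = b`. -/
def DihLabel.Swaps {c : ℕ} (t : DihLabel) (e e' : DihEdge c) : Prop :=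
  ∃ k : ℕ, (match t with | a => Even k | b => Odd k) ∧
    ((e.idx = k ∧ e'.idx = k + 1) ∨ (e'.idx = k ∧ e.idx = k + 1))

/-- The tile inflation process of the action: at the start both labels hang at both vertices, and
boundary points `γ`, `γ'` at which `F` has the same nontrivial section `t` are connected in their
copies `e γ`, `e' γ'` by an edge labelled by `F` if `t` interchanges the edges `e`, `e'`. -/
def dihInflation (c : ℕ → ℕ+) : InflationData (dihDiagram c) DihLabel where
  bdry₀ _ _ := True
  conn n _ F x y := ∃ t : DihLabel,
    dihSection c F n _ x.2 = some t ∧ dihSection c F n _ y.2 = some t ∧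
      t.Swaps (c := c n) x.1.1 y.1.1

/-! ### Edges of a tower -/

namespace DihEdge

variable {c : ℕ}

/-! Read backwards, the automaton of sections is deterministic: in a given tower a section `a`
arises only from `b` on the bottom edge, and a section `b` only on the top edge, from the one
reflection which does not interchange the last two indices. So every finite tile has exactly one
vertex with section `a` and one with section `b` (`dihSection_unique`, `exists_dihSection`).
Consequently, each tile is a segment, obtained by stringing the segments of the level before along a
tower, with alternating orientation.

For bounded type, the inflation laws, the extension to homeomorphisms and the finiteness of the
boundary hold for every sequence `c` (`dihInflation_isTileInflation`, `dihInflation_extendsTo`,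
`finite_isBdryPoint`). The only condition left is a bound on the number `2 * c n + 1` of edges.

For repetitivity, a segment has diameter one less than its size (`diam_tileGraph_add_one`), and the
two tiles of a level have sizes within a factor 2 (`tileSize_bounds`). If `c n ≤ M`, every tile of
level `n + 2` contains both tiles of level `n` and is larger by a factor of at most `(M + 2) ^ 2`;
this gives repetitivity on infinite tiles, hence on the larger orbital graphs. Conversely, a copy of
the tile of the vertex `0` of level `n` occurs only at the bottom of a tower, while the middle of a
tower is about `c n / 2` copies away from both ends. The distance to the ends of the tile of level
`n + 1` is 1-Lipschitz even on orbital graphs (`endDist_dihMap`), so linear repetitivity there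
bounds `c n`. -/

theorem src_eq_zero_iff {e : DihEdge c} : e.src = 0 ↔ e.idx = 0 := by
  unfold src; split_ifs <;> simp_all

/-- The edge with given index and range. -/
theorem exists_idx_rng (v : Fin 2) {k : ℕ} (h : k + (v : ℕ) ≤ c) :
    ∃ e : DihEdge c, e.idx = k ∧ e.rng = v := by
  match v with
  | 0 => exact ⟨Sum.inl ⟨k, by simp at h; omega⟩, rfl, rfl⟩
  | 1 => exact ⟨Sum.inr ⟨k, by simp at h; omega⟩, rfl, rfl⟩

end DihEdge

namespace DihLabel

variable {c : ℕ}

theorem next_eq_some_a {s : DihLabel} {e : DihEdge c} :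
    s.next e = some a ↔ s = b ∧ e.idx = 0 := by
  cases s <;> simp only [next] <;> split_ifs <;> simp_all

theorem next_eq_some_b {s : DihLabel} {e : DihEdge c} :
    s.next e = some b ↔ e.IsTop ∧ s = if e.idx % 2 = 1 then b else a := by
  cases s <;> simp only [next] <;> split_ifs <;> simp_all

/-- Backward determinism: `a` comes only from `b` at index 0. `b` comes only from the top edge,
whose parity fixes the reflection. -/
theorem eq_of_next_eq_some {s s' t : DihLabel} {e e' : DihEdge c} (hr : e.rng = e'.rng)
    (h : s.next e = some t) (h' : s'.next e' = some t) : s = s' ∧ e = e' := by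
  cases t with
  | a =>
    rw [next_eq_some_a] at h h'
    exact ⟨h.1.trans h'.1.symm, DihEdge.ext_idx_rng (h.2.trans h'.2.symm) hr⟩
  | b =>
    rw [next_eq_some_b, DihEdge.isTop_iff] at h h'
    have he : e = e' := DihEdge.ext_idx_rng (by rw [← hr] at h'; omega) hr
    subst he
    exact ⟨h.2.trans h'.2.symm, rfl⟩

theorem Swaps.symm {t : DihLabel} {e e' : DihEdge c} (h : t.Swaps e e') : t.Swaps e' e := by
  obtain ⟨k, hk, h⟩ := h
  exact ⟨k, hk, h.symm⟩

theorem Swaps.next_eq_none {t : DihLabel} {e e' : DihEdge c} (h : t.Swaps e e')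
    (hr : e.rng = e'.rng) : t.next e = none := by
  obtain ⟨k, hk, h⟩ := h
  have h1 := e'.idx_add_rng_le
  rw [← hr] at h1
  have h2 := e.isTop_iff
  cases t <;> simp only [next, Nat.even_iff, Nat.odd_iff] at hk ⊢ <;> split_ifs <;> simp_all <;>
    omega

theorem Swaps.outIdx_eq {t : DihLabel} {e e' : DihEdge c} (h : t.Swaps e e')
    (hr : e.rng = e'.rng) : t.outIdx e = e'.idx := by
  obtain ⟨k, hk, h⟩ := h
  have h1 := e'.idx_add_rng_le
  rw [← hr] at h1
  have h2 := e.isTop_iff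
  cases t <;> simp only [outIdx, Nat.even_iff, Nat.odd_iff] at hk ⊢ <;> split_ifs <;> simp_all <;>
    omega

theorem swaps_of_next_eq_none {t : DihLabel} {e e' : DihEdge c} (h : t.next e = none)
    (h' : e'.idx = t.outIdx e) : t.Swaps e e' := by
  by_cases hk : e'.idx = e.idx + 1
  · refine ⟨e.idx, ?_, Or.inl ⟨rfl, hk⟩⟩
    cases t <;> simp only [next, outIdx, Nat.even_iff, Nat.odd_iff] at * <;>
      split_ifs at * <;> simp_all
  · refine ⟨e'.idx, ?_, Or.inr ⟨rfl, ?_⟩⟩ <;>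
    cases t <;> simp only [next, outIdx, Nat.even_iff, Nat.odd_iff] at * <;>
      split_ifs at * <;> simp_all <;> omega

theorem exists_swaps_of_next_eq_none {t : DihLabel} {e : DihEdge c} (h : t.next e = none) :
    ∃ e' : DihEdge c, e'.rng = e.rng ∧ t.Swaps e e' := by
  have h1 := e.idx_add_rng_le
  have h2 := e.isTop_iff
  obtain ⟨e', h3, h4⟩ := DihEdge.exists_idx_rng (c := c) e.rng (k := t.outIdx e) (by
    cases t <;> simp only [next, outIdx] at * <;> split_ifs at * <;> simp_all <;> omega)
  exact ⟨e', h4, swaps_of_next_eq_none h h3⟩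

/-- The reflection `b` pairs an odd index with its successor, so index 0 is never involved and both
sources are `1`. For `a` this fails on the pair 0, 1. -/
theorem Swaps.src_eq {e e' : DihEdge c} (h : b.Swaps e e') : e.src = e'.src := by
  obtain ⟨k, hk, h⟩ := h
  simp only [Nat.odd_iff] at hk
  unfold DihEdge.src
  rw [if_neg (by omega), if_neg (by omega)]

end DihLabel

/-! ### Boundary vertices of the tiles -/

section Tiles

variable {c : ℕ → ℕ+}

theorem dihSection_succ_eq_some {n : ℕ} {v : (dihDiagram c).V (n + 1)} {F t : DihLabel}
    {x : (dihDiagram c).Path (n + 1) v} : dihSection c F (n + 1) v x = some t ↔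
      ∃ s, dihSection c F n _ x.2 = some s ∧ s.next (c := c n) x.1.1 = some t :=
  Option.bind_eq_some_iff

/-- Backward determinism, applied edge by edge from the last one: the final section determines both
the label and the whole path. -/
theorem dihSection_unique : ∀ {n : ℕ} {v : (dihDiagram c).V n} {F F' t : DihLabel}
    {γ γ' : (dihDiagram c).Path n v}, dihSection c F n v γ = some t →
    dihSection c F' n v γ' = some t → F = F' ∧ γ = γ'
  | 0, _, _, _, _, _, _, h, h' => ⟨Option.some.inj (h.trans h'.symm), rfl⟩
  | n + 1, v, F, F', t, ⟨⟨e, he⟩, γ⟩, ⟨⟨e', he'⟩, γ'⟩, h, h' => by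
    obtain ⟨s, hs, h⟩ := dihSection_succ_eq_some.1 h
    obtain ⟨s', hs', h'⟩ := dihSection_succ_eq_some.1 h'
    obtain ⟨rfl, rfl⟩ := DihLabel.eq_of_next_eq_some (he.trans he'.symm) h h'
    obtain ⟨rfl, rfl⟩ := dihSection_unique hs hs'
    exact ⟨rfl, rfl⟩

/-- The label with section `a` does not depend on `v`: a section `a` on level `n + 1` comes from
section `b` below a bottom edge, and all bottom edges start in the same vertex `0`. This
independence is needed because `a` joins copies of the two different tiles at indices 0 and 1. For
`b` the label may depend on `v`. -/
theorem exists_dihSection (c : ℕ → ℕ+) : ∀ n : ℕ,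
    (∃ F, ∀ v, ∃ γ, dihSection c F n v γ = some DihLabel.a) ∧
    ∀ v, ∃ F γ, dihSection c F n v γ = some DihLabel.b
  | 0 => ⟨⟨DihLabel.a, fun _ => ⟨(), rfl⟩⟩, fun _ => ⟨DihLabel.b, (), rfl⟩⟩
  | n + 1 => by
    obtain ⟨⟨A, hA⟩, hB⟩ := exists_dihSection c n
    have hc := (c n).pos
    constructor
    · obtain ⟨F, γ, h⟩ := hB (0 : Fin 2)
      refine ⟨F, fun (v : Fin 2) => ?_⟩
      obtain ⟨e, h0, hv⟩ := DihEdge.exists_idx_rng (c := c n) v (k := 0) (by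
        have : (v : ℕ) < 2 := v.2
        omega)
      obtain ⟨γ', h'⟩ : ∃ γ' : (dihDiagram c).Path n e.src,
          dihSection c F n _ γ' = some DihLabel.b := by
        rw [DihEdge.src_eq_zero_iff.2 h0]
        exact ⟨γ, h⟩
      exact ⟨⟨⟨e, hv⟩, γ'⟩, dihSection_succ_eq_some.2
        ⟨DihLabel.b, h', DihLabel.next_eq_some_a.2 ⟨rfl, h0⟩⟩⟩
    · intro (v : Fin 2)
      -- The index `c n - v` is that of the top of the tower over `v`.
      obtain ⟨e, h0, hv⟩ := DihEdge.exists_idx_rng (c := c n) v (k := (c n : ℕ) - (v : ℕ)) (by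
        have : (v : ℕ) < 2 := v.2
        omega)
      have ht : e.IsTop := by
        rw [DihEdge.isTop_iff, h0, hv]
        have : (v : ℕ) < 2 := v.2
        omega
      have key : ∃ F γ, dihSection c F n e.src γ =
          some (if e.idx % 2 = 1 then DihLabel.b else DihLabel.a) := by
        split_ifs
        · exact hB _
        · exact ⟨A, hA _⟩
      obtain ⟨F, γ, h⟩ := key
      exact ⟨F, ⟨⟨e, hv⟩, γ⟩, dihSection_succ_eq_some.2
        ⟨_, h, DihLabel.next_eq_some_b.2 ⟨ht, rfl⟩⟩⟩

theorem exists_dihSection_eq (n : ℕ) (v : (dihDiagram c).V n) (t : DihLabel) :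
    ∃ F γ, dihSection c F n v γ = some t := by
  cases t with
  | a => exact (exists_dihSection c n).1.imp fun _ h => h v
  | b => exact (exists_dihSection c n).2 v

/-- Boundary edges of the tiles at both sides of a connector carry the same label. -/
theorem exists_dihSection_of_swaps {n : ℕ} {F t : DihLabel} {e e' : DihEdge (c n)}
    (h : t.Swaps e e') {γ : (dihDiagram c).Path n e.src} (hγ : dihSection c F n _ γ = some t) :
    ∃ γ' : (dihDiagram c).Path n e'.src, dihSection c F n _ γ' = some t := by
  cases t with
  | a =>
    obtain ⟨A, hA⟩ := (exists_dihSection c n).1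
    obtain ⟨γ'', h''⟩ := hA e.src
    obtain ⟨rfl, -⟩ := dihSection_unique hγ h''
    exact hA _
  | b => rw [← h.src_eq]; exact ⟨γ, hγ⟩

/-- A boundary edge is consumed by a connector precisely when its section dies on the next edge.
This matches the recursion of `HasBdryEdge` with that of `dihSection`. -/
theorem exists_conn_iff {n : ℕ} {v : (dihDiagram c).V (n + 1)} {F t : DihLabel}
    {x : (dihDiagram c).Path (n + 1) v} (h : dihSection c F n _ x.2 = some t) :
    (∃ y, (dihInflation c).conn n v F x y) ↔ t.next (c := c n) x.1.1 = none := by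
  constructor
  · rintro ⟨y, s, hs, -, hsw⟩
    obtain rfl := Option.some.inj (h.symm.trans hs)
    exact hsw.next_eq_none (x.1.2.trans y.1.2.symm)
  · intro hn
    obtain ⟨e', hr, hsw⟩ := DihLabel.exists_swaps_of_next_eq_none hn
    obtain ⟨γ', h'⟩ := exists_dihSection_of_swaps hsw h
    exact ⟨⟨⟨e', hr.trans x.1.2⟩, γ'⟩, t, h, h', hsw⟩

theorem hasBdryEdge_iff : ∀ {n : ℕ} {v : (dihDiagram c).V n} {F : DihLabel}
    {γ : (dihDiagram c).Path n v},
    (dihInflation c).HasBdryEdge n v F γ ↔ ∃ t, dihSection c F n v γ = some t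
  | 0, _, F, _ => ⟨fun _ => ⟨F, rfl⟩, fun _ => trivial⟩
  | n + 1, v, F, x => by
    simp only [InflationData.HasBdryEdge, hasBdryEdge_iff (n := n)]
    constructor
    · rintro ⟨⟨t, ht⟩, h⟩
      rw [exists_conn_iff ht, ← ne_eq, Option.ne_none_iff_exists'] at h
      obtain ⟨s, hs⟩ := h
      exact ⟨s, dihSection_succ_eq_some.2 ⟨t, ht, hs⟩⟩
    · rintro ⟨s, hs⟩
      rw [dihSection_succ_eq_some] at hs
      obtain ⟨t, ht, hs⟩ := hs
      refine ⟨⟨t, ht⟩, ?_⟩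
      rw [exists_conn_iff ht, hs]
      simp

/-! ### The tiles are connected -/

theorem tileGraph_reachable_copy {n : ℕ} {v : (dihDiagram c).V (n + 1)}
    (e : {e : DihEdge (c n) // e.rng = v})
    (h : ((dihInflation c).tileGraph n e.1.src).Connected) (γ γ' : (dihDiagram c).Path n e.1.src) :
    ((dihInflation c).tileGraph (n + 1) v).Reachable ⟨e, γ⟩ ⟨e, γ'⟩ := by
  let f : (dihInflation c).tileGraph n e.1.src →g (dihInflation c).tileGraph (n + 1) v :=
    { toFun := fun γ => ⟨e, γ⟩
      map_rel' := by
        intro x y hxy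
        simp only [InflationData.tileGraph, SimpleGraph.fromRel_adj] at hxy ⊢
        refine ⟨fun h => hxy.1 (eq_of_heq (Sigma.mk.inj h).2), hxy.2.imp ?_ ?_⟩
        · exact fun ⟨F, hF⟩ => ⟨F, Or.inr ⟨e, x, y, rfl, rfl, hF⟩⟩
        · exact fun ⟨F, hF⟩ => ⟨F, Or.inr ⟨e, y, x, rfl, rfl, hF⟩⟩ }
  exact (h.preconnected γ γ').map f

/-- Descent along the tower: inside a copy one moves to the boundary vertex whose section
interchanges its index with the one below, and crosses the connector there, until the copy of index
0 is reached. -/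
theorem tileGraph_connected : ∀ (n : ℕ) (v : (dihDiagram c).V n),
    ((dihInflation c).tileGraph n v).Connected
  | 0, _ => @SimpleGraph.Connected.mk _ _ (fun _ _ => SimpleGraph.Reachable.refl _) ⟨()⟩
  | n + 1, v => by
    have hc := (c n).pos
    obtain ⟨e₀, h0, h0v⟩ := DihEdge.exists_idx_rng (c := c n) v (k := 0) (by
      have := Fin.is_lt (n := 2) v
      omega)
    obtain ⟨-, γ₀, -⟩ := exists_dihSection_eq (c := c) n e₀.src DihLabel.a
    let x₀ : (dihDiagram c).Path (n + 1) v := ⟨⟨e₀, h0v⟩, γ₀⟩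
    have key : ∀ (k : ℕ) (e : DihEdge (c n)) (he : e.rng = v) (γ : (dihDiagram c).Path n e.src),
        e.idx = k → ((dihInflation c).tileGraph (n + 1) v).Reachable ⟨⟨e, he⟩, γ⟩ x₀ := by
      intro k
      induction k with
      | zero =>
        intro e he γ hk
        obtain rfl : e = e₀ := DihEdge.ext_idx_rng (hk.trans h0.symm) (he.trans h0v.symm)
        exact tileGraph_reachable_copy ⟨e, he⟩ (tileGraph_connected n _) _ _
      | succ k ih =>
        intro e he γ hk
        have h1 := e.idx_add_rng_le
        obtain ⟨e', hk', he'⟩ := DihEdge.exists_idx_rng (c := c n) e.rng (k := k) (by omega)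
        obtain ⟨t, ht⟩ : ∃ t : DihLabel, t.Swaps e e' := by
          rcases Nat.even_or_odd k with h | h
          · exact ⟨DihLabel.a, k, h, Or.inr ⟨hk', hk⟩⟩
          · exact ⟨DihLabel.b, k, h, Or.inr ⟨hk', hk⟩⟩
        obtain ⟨F, δ, hδ⟩ := exists_dihSection_eq (c := c) n e.src t
        obtain ⟨δ', hδ'⟩ := exists_dihSection_of_swaps ht hδ
        refine (tileGraph_reachable_copy ⟨e, he⟩ (tileGraph_connected n _) γ δ).trans
          (SimpleGraph.Reachable.trans ?_ (ih e' (he'.trans he) δ' hk'))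
        refine SimpleGraph.Adj.reachable ((SimpleGraph.fromRel_adj _ _ _).2 ⟨fun h => ?_, Or.inl
          ⟨F, Or.inl ⟨t, hδ, hδ', ht⟩⟩⟩)
        have := congrArg (fun x : (dihDiagram c).Path (n + 1) v => DihEdge.idx (c := c n) x.1.1) h
        change e.idx = e'.idx at this
        omega
    have : Nonempty ((dihDiagram c).Path (n + 1) v) := ⟨x₀⟩
    exact ⟨fun x y => (key _ x.1.1 x.1.2 x.2 rfl).trans (key _ y.1.1 y.1.2 y.2 rfl).symm⟩

theorem dihInflation_isTileInflation (c : ℕ → ℕ+) : (dihInflation c).IsTileInflation where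
  conn_bdry := by
    rintro n v F x y ⟨t, hx, hy, -⟩
    exact ⟨hasBdryEdge_iff.2 ⟨t, hx⟩, hasBdryEdge_iff.2 ⟨t, hy⟩⟩
  conn_inv := by
    rintro n v F x y ⟨t, hx, hy, h⟩
    exact ⟨t, hy, hx, h.symm⟩
  conn_unique := by
    rintro n v F x ⟨⟨e, he⟩, γ⟩ ⟨⟨e', he'⟩, γ'⟩ ⟨t, hx, hy, h⟩ ⟨t', hx', hy', h'⟩
    obtain rfl := Option.some.inj (hx.symm.trans hx')
    obtain rfl : e = e' := DihEdge.ext_idx_rng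
      ((h.outIdx_eq (x.1.2.trans he.symm)).symm.trans (h'.outIdx_eq (x.1.2.trans he'.symm)))
      (he.trans he'.symm)
    obtain ⟨-, rfl⟩ := dihSection_unique hy hy'
    rfl
  connected := tileGraph_connected

end Tiles

/-! ### The generators act on infinite tiles by their labels -/

theorem BratteliDiagram.trunc_succ_of_edge_eq {B : BratteliDiagram} {ω : B.Omega} {n : ℕ}
    {e : B.E n} (he : ω.edge n = e) {v : B.V (n + 1)} (h : B.src (n + 1) (ω.edge (n + 1)) = v) :
    B.trunc ω (n + 1) v h =
      ⟨⟨e, by rw [← he]; exact (ω.compat n).trans h⟩, B.trunc ω n _ (congrArg _ he)⟩ := by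
  subst he
  rfl

section Action

variable {c : ℕ → ℕ+}

theorem dihState_eq_dihSection (F : DihLabel) (ω : (dihDiagram c).Omega) :
    ∀ (n : ℕ) (v : (dihDiagram c).V n) (h : (dihDiagram c).src n (ω.edge n) = v),
      dihSection c F n v ((dihDiagram c).trunc ω n v h) = dihState F ω.edge n
  | 0, _, _ => rfl
  | n + 1, v, h => by
    change ((dihSection c F n _ ((dihDiagram c).trunc ω n _ rfl)).bind _) = _
    rw [dihState_eq_dihSection F ω n _ rfl]
    rfl

theorem edge_eq_of_trunc_eq {B : BratteliDiagram} {ω ω' : B.Omega} :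
    ∀ {n : ℕ} {v : B.V n} {h : B.src n (ω.edge n) = v} {h' : B.src n (ω'.edge n) = v},
      B.trunc ω n v h = B.trunc ω' n v h' → ∀ m < n, ω.edge m = ω'.edge m
  | 0, _, _, _, _, m, hm => by omega
  | n + 1, v, h, h', he, m, hm => by
    have h1 : ω.edge n = ω'.edge n := congrArg (fun x : B.Path (n + 1) v => x.1.1) he
    rcases Nat.lt_succ_iff_lt_or_eq.1 hm with hm | rfl
    · rw [BratteliDiagram.trunc_succ_of_edge_eq h1 h,
        BratteliDiagram.trunc_succ_of_edge_eq rfl h'] at he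
      exact edge_eq_of_trunc_eq (eq_of_heq (Sigma.mk.inj he).2) m hm
    · exact h1

theorem dihState_succ {F t : DihLabel} {f : (n : ℕ) → DihEdge (c n)} {n : ℕ}
    (h : dihState F f n = some t) : dihState F f (n + 1) = t.next (f n) := by
  rw [dihState, h, Option.bind_some]

theorem dihState_eq_none_of_le {F : DihLabel} {f : (n : ℕ) → DihEdge (c n)} {n m : ℕ}
    (hnm : n ≤ m) (h : dihState F f n = none) : dihState F f m = none := by
  induction m, hnm using Nat.le_induction with
  | base => exact h
  | succ m _ ih => rw [dihState, ih, Option.bind_none]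

theorem rng_dihImage_of_eq_none {F : DihLabel} {f : (n : ℕ) → DihEdge (c n)}
    (hf : ∀ n, (f n).rng = (f (n + 1)).src) {n : ℕ} (h : dihState F f (n + 1) = none) :
    (dihImage F f hf n).rng = (f n).rng := by
  rw [rng_dihImage, h, hf n]
  rfl

theorem dihImage_eq_of_eq_none {F : DihLabel} {f : (n : ℕ) → DihEdge (c n)}
    (hf : ∀ n, (f n).rng = (f (n + 1)).src) {n : ℕ} (h : dihState F f n = none) :
    dihImage F f hf n = f n :=
  DihEdge.ext_idx_rng (by rw [idx_dihImage, h]; rfl)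
    (rng_dihImage_of_eq_none hf (dihState_eq_none_of_le n.le_succ h))

/-- At a connector the section is alive up to edge `n` and dies there, so the tail is fixed and edge
`n` is swapped. Arrows inside a copy reduce to the level before. -/
theorem dihMap_eq_of_infEdge {F : DihLabel} {ω ω' : (dihDiagram c).Omega} :
    ∀ {n : ℕ} {v : (dihDiagram c).V n} {h : (dihDiagram c).src n (ω.edge n) = v}
      {h' : (dihDiagram c).src n (ω'.edge n) = v},
    (∀ m, n ≤ m → ω.edge m = ω'.edge m) →
    (dihInflation c).Edge n v F ((dihDiagram c).trunc ω n v h) ((dihDiagram c).trunc ω' n v h') →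
    dihMap c F ω = ω'
  | 0, _, _, _, _, hE => hE.elim
  | n + 1, v, h, h', htail, Or.inl ⟨t, hx, hy, hsw⟩ => by
    have hs : dihState F ω.edge n = some t := (dihState_eq_dihSection F ω n _ rfl).symm.trans hx
    have hs' : dihState F ω'.edge n = some t :=
      (dihState_eq_dihSection F ω' n _ rfl).symm.trans hy
    replace hsw : t.Swaps (c := c n) (ω.edge n) (ω'.edge n) := hsw
    have hr : DihEdge.rng (c := c n) (ω.edge n) = DihEdge.rng (c := c n) (ω'.edge n) :=
      ((ω.compat n).trans h).trans ((ω'.compat n).trans h').symm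
    have hs1 : dihState F ω.edge (n + 1) = none :=
      (dihState_succ hs).trans (hsw.next_eq_none hr)
    have htl : ∀ m, n + 1 ≤ m → (dihMap c F ω).edge m = ω'.edge m := fun m hm =>
      (dihImage_eq_of_eq_none ω.compat (dihState_eq_none_of_le hm hs1)).trans (htail m hm)
    have hn : (dihMap c F ω).edge n = ω'.edge n := by
      refine DihEdge.ext_idx_rng (c := c n) ?_ ((rng_dihImage_of_eq_none ω.compat hs1).trans hr)
      refine (idx_dihImage F ω.edge ω.compat n).trans ?_
      rw [hs]
      exact hsw.outIdx_eq hr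
    have hs2 : dihState F (dihMap c F ω).edge n = some t :=
      (dihState_dihImage F ω.edge ω.compat n).trans hs
    -- The first `n` edges are not computed: the image has the same section `t` under `F` as `ω'`,
    -- and only one vertex of the tile has that section.
    have key := (dihSection_unique
      ((dihState_eq_dihSection F (dihMap c F ω) n _ (by rw [hn])).trans hs2)
      ((dihState_eq_dihSection F ω' n _ rfl).trans hs')).2
    refine BratteliDiagram.Omega.ext (funext fun m => ?_)
    rcases lt_trichotomy m n with hm | rfl | hm
    · exact edge_eq_of_trunc_eq key m hm
    · exact hn
    · exact htl m hm
  | n + 1, v, h, h', htail, Or.inr ⟨e, γ, γ', hx, hy, hE⟩ => by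
    have hxe : ω.edge n = e.1 :=
      congrArg (fun x : (dihDiagram c).Path (n + 1) v => x.1.1) hx
    have hye : ω'.edge n = e.1 :=
      congrArg (fun x : (dihDiagram c).Path (n + 1) v => x.1.1) hy
    refine dihMap_eq_of_infEdge (n := n) (h := congrArg _ hxe) (h' := congrArg _ hye) ?_ ?_
    · intro m hm
      rcases hm.eq_or_lt with rfl | hm
      · rw [hxe, hye]
      · exact htail m hm
    · rw [BratteliDiagram.trunc_succ_of_edge_eq hxe h] at hx
      rw [BratteliDiagram.trunc_succ_of_edge_eq hye h'] at hy
      rw [eq_of_heq (Sigma.mk.inj hx).2, eq_of_heq (Sigma.mk.inj hy).2]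
      exact hE

/-- Where the section becomes trivial, a point and its image are neighbours in a finite tile. -/
theorem edge_trunc_dihMap {F : DihLabel} {ω : (dihDiagram c).Omega} :
    ∀ {n : ℕ}, dihState F ω.edge n = none → ∀ (v : (dihDiagram c).V n)
      (h : (dihDiagram c).src n (ω.edge n) = v)
      (h' : (dihDiagram c).src n ((dihMap c F ω).edge n) = v),
      (dihInflation c).Edge n v F ((dihDiagram c).trunc ω n v h)
        ((dihDiagram c).trunc (dihMap c F ω) n v h')
  | 0, hn, _, _, _ => by cases hn
  | n + 1, hn, v, h, h' => by
    cases hs : dihState F ω.edge n with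
    | none =>
      have he : (dihMap c F ω).edge n = ω.edge n := dihImage_eq_of_eq_none ω.compat hs
      exact Or.inr ⟨⟨ω.edge n, _⟩, _, _, rfl, BratteliDiagram.trunc_succ_of_edge_eq he h',
        edge_trunc_dihMap hs _ rfl _⟩
    | some t =>
      refine Or.inl ⟨t, (dihState_eq_dihSection F ω n _ rfl).trans hs,
        (dihState_eq_dihSection F (dihMap c F ω) n _ rfl).trans
          ((dihState_dihImage F ω.edge ω.compat n).trans hs), ?_⟩
      refine DihLabel.swaps_of_next_eq_none ((dihState_succ hs).symm.trans hn)
        ((idx_dihImage F ω.edge ω.compat n).trans ?_)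
      rw [hs]
      rfl

theorem dihState_congr {F : DihLabel} {f g : (n : ℕ) → DihEdge (c n)} {n : ℕ}
    (h : ∀ m < n, f m = g m) : dihState F f n = dihState F g n := by
  induction n with
  | zero => rfl
  | succ n ih =>
    rw [dihState, dihState, ih fun m hm => h m (by omega), h n (by omega)]

theorem dihImage_congr {F : DihLabel} {f g : (n : ℕ) → DihEdge (c n)}
    (hf : ∀ n, (f n).rng = (f (n + 1)).src) (hg : ∀ n, (g n).rng = (g (n + 1)).src) {n : ℕ}
    (h : ∀ m ≤ n + 1, f m = g m) : dihImage F f hf n = dihImage F g hg n := by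
  apply DihEdge.ext_idx_rng
  · rw [idx_dihImage, idx_dihImage, dihState_congr fun m hm => h m (by omega), h n (by omega)]
  · rw [rng_dihImage, rng_dihImage, dihState_congr fun m hm => h m (by omega),
      h (n + 1) (by omega)]

/-- Edge `n` of the image depends only on the edges up to `n + 1` of the point; edge `n + 1` enters
through the range of the image edge. -/
theorem continuous_dihMap (c : ℕ → ℕ+) (F : DihLabel) : Continuous (dihMap c F) := by
  let _ : ∀ n, TopologicalSpace ((dihDiagram c).E n) := fun _ => ⊥
  have (n : ℕ) : DiscreteTopology ((dihDiagram c).E n) := ⟨rfl⟩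
  have hc : Continuous (BratteliDiagram.Omega.edge (B := dihDiagram c)) := continuous_induced_dom
  refine continuous_induced_rng.2 (continuous_pi fun n => ?_)
  refine continuous_discrete_rng.2 fun e => isOpen_iff_mem_nhds.2 fun ω hω => ?_
  have hmem : ∀ m, {η : (dihDiagram c).Omega | η.edge m = ω.edge m} ∈ nhds ω := fun m =>
    ((isOpen_discrete {ω.edge m}).preimage ((continuous_apply m).comp hc)).mem_nhds rfl
  filter_upwards [(Filter.biInter_mem (Set.finite_Iic (n + 1))).2 fun m _ => hmem m] with η hη
  have hη' : ∀ m ≤ n + 1, η.edge m = ω.edge m := by simpa using hη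
  exact (dihImage_congr η.compat ω.compat hη').trans hω

/-- If the section of `F` dies at some level, the image is a neighbour within the infinite tile. So
without an arrow `F` at `ω` the section survives at all levels, which is a boundary edge at every
truncation. -/
theorem dihInflation_extendsTo (c : ℕ → ℕ+) : (dihInflation c).ExtendsTo (dihAct c) := by
  refine ⟨continuous_dihMap c, fun F => rfl, ?_, ?_⟩
  · rintro F ω ω' ⟨n, v, h, h', htail, hE⟩
    exact dihMap_eq_of_infEdge htail hE
  · intro F ω hω n
    rw [hasBdryEdge_iff, ← Option.ne_none_iff_exists', dihState_eq_dihSection]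
    intro hn
    exact hω ⟨dihMap c F ω, n, _, rfl, _,
      fun m hm => (dihImage_eq_of_eq_none ω.compat (dihState_eq_none_of_le hm hn)).symm,
      edge_trunc_dihMap hn _ rfl
        (congrArg DihEdge.src (dihImage_eq_of_eq_none ω.compat hn))⟩

/-! ### Bounded type -/

theorem encard_isBdryVertex_le (c : ℕ → ℕ+) (n : ℕ) (v : (dihDiagram c).V n) :
    {γ : (dihDiagram c).Path n v | (dihInflation c).IsBdryVertex n v γ}.encard ≤ (2 : ℕ) := by
  obtain ⟨F, γ, h⟩ := exists_dihSection_eq (c := c) n v DihLabel.a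
  obtain ⟨F', γ', h'⟩ := exists_dihSection_eq (c := c) n v DihLabel.b
  refine (Set.encard_le_encard (t := {γ, γ'}) ?_).trans
    ((Set.encard_insert_le _ _).trans (by rw [Set.encard_singleton]; rfl))
  rintro δ ⟨G, hG⟩
  obtain ⟨t, ht⟩ := hasBdryEdge_iff.1 hG
  cases t with
  | a => exact Or.inl (dihSection_unique ht h).2
  | b => exact Or.inr (dihSection_unique ht h').2

/-- There are at most four: on a level where finitely many given boundary points have distinct
truncations, a truncation is determined by its end vertex and a surviving section, two choices each.
Five points contradict the pigeonhole principle. -/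
theorem finite_isBdryPoint (c : ℕ → ℕ+) :
    {ω : (dihDiagram c).Omega | (dihInflation c).IsBdryPoint ω}.Finite := by
  classical
  have hb : ∀ ω, (dihInflation c).IsBdryPoint ω → ∀ n, ∃ p : DihLabel × DihLabel,
      dihState p.1 ω.edge n = some p.2 := by
    intro ω hω n
    obtain ⟨F, hF⟩ := hω n
    obtain ⟨t, ht⟩ := hasBdryEdge_iff.1 hF
    exact ⟨(F, t), by rw [← dihState_eq_dihSection F ω n _ rfl]; exact ht⟩
  by_contra hinf
  obtain ⟨S, hS, hcard⟩ := Set.Infinite.exists_subset_card_eq hinf 5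
  have hsep : ∀ ω ω' : (dihDiagram c).Omega, ∃ N, ∀ n, N ≤ n → ω ≠ ω' →
      ∃ m < n, ω.edge m ≠ ω'.edge m := by
    intro ω ω'
    by_cases h : ω = ω'
    · exact ⟨0, fun _ _ h' => (h' h).elim⟩
    · obtain ⟨m, hm⟩ : ∃ m, ω.edge m ≠ ω'.edge m := by
        by_contra! hh
        exact h (BratteliDiagram.Omega.ext (funext hh))
      exact ⟨m + 1, fun n hn _ => ⟨m, hn, hm⟩⟩
  choose N hN using hsep
  let n := S.sup fun ω => S.sup fun ω' => N ω ω'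
  have hn : ∀ ω ∈ S, ∀ ω' ∈ S, N ω ω' ≤ n := fun ω hω ω' hω' =>
    (Finset.le_sup (f := fun ω' => N ω ω') hω').trans
      (Finset.le_sup (f := fun ω => S.sup fun ω' => N ω ω') hω)
  have : Nonempty (DihLabel × DihLabel) := ⟨(DihLabel.a, DihLabel.a)⟩
  choose! p hp using fun ω hω => hb ω hω n
  let f : (dihDiagram c).Omega → Fin 2 × Bool := fun ω =>
    (DihEdge.src (c := c n) (ω.edge n), match (p ω).2 with | .a => true | .b => false)
  obtain ⟨ω, hω, ω', hω', hne, hf⟩ := Finset.exists_ne_map_eq_of_card_lt_of_maps_to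
    (s := S) (t := Finset.univ) (f := f) (by rw [hcard]; simp) (fun _ _ => Finset.mem_univ _)
  obtain ⟨m, hm, hme⟩ := hN ω ω' n (hn ω hω ω' hω') hne
  have h1 : DihEdge.src (c := c n) (ω.edge n) = DihEdge.src (c := c n) (ω'.edge n) :=
    congrArg Prod.fst hf
  have h2 : (p ω).2 = (p ω').2 := by
    have := congrArg Prod.snd hf
    simp only [f] at this
    cases h : (p ω).2 <;> cases h' : (p ω').2 <;> simp_all
  have h3 := hp ω (hS hω)
  rw [h2] at h3
  exact hme (edge_eq_of_trunc_eq (dihSection_unique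
    ((dihState_eq_dihSection _ ω n _ h1).trans h3)
    ((dihState_eq_dihSection _ ω' n _ rfl).trans (hp ω' (hS hω')))).2 m hm)

theorem isGroupOfBoundedType_iff (c : ℕ → ℕ+) :
    (dihInflation c).IsGroupOfBoundedType (dihAct c) ↔ ∃ M : ℕ, ∀ n, (c n : ℕ) ≤ M := by
  have hE : ∀ n, Nat.card ((dihDiagram c).E n) = 2 * (c n : ℕ) + 1 := by
    intro n
    change Nat.card (Fin (c n + 1) ⊕ Fin (c n)) = _
    simp
    ring
  have hV : ∀ n, Nat.card ((dihDiagram c).V n) = 2 := fun n => Nat.card_fin 2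
  constructor
  · rintro ⟨-, -, ⟨-, -, N, hN⟩, -⟩
    exact ⟨N, fun n => by have := (hN n).2; rw [hE] at this; omega⟩
  · rintro ⟨M, hM⟩
    refine ⟨Finite.of_surjective (fun x : Bool => if x then DihLabel.a else DihLabel.b) ?_,
      dihInflation_isTileInflation c,
      ⟨⟨2, encard_isBdryVertex_le c⟩, finite_isBdryPoint c, 2 * M + 2, fun n => ?_⟩,
      dihInflation_extendsTo c⟩
    · rintro (_ | _)
      exacts [⟨true, rfl⟩, ⟨false, rfl⟩]
    · have := hM n
      rw [hE, hV]
      omega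

end Action

/-! ### Positions in the tiles -/

instance BratteliDiagram.finite_path (B : BratteliDiagram) :
    ∀ (n : ℕ) (v : B.V n), Finite (B.Path n v)
  | 0, _ => inferInstanceAs (Finite Unit)
  | n + 1, v => by
    have := B.finite_E n
    have := fun v => BratteliDiagram.finite_path B n v
    exact inferInstanceAs
      (Finite ((e : {e : B.E n // B.rng n e = v}) × B.Path n (B.src n e.1)))

theorem DihEdge.sum_rng_eq {c : ℕ} [∀ v : Fin 2, Fintype {e : DihEdge c // e.rng = v}]
    (v : Fin 2) (f : Fin 2 → ℕ) :
    ∑ e : {e : DihEdge c // e.rng = v}, f e.1.src =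
      ∑ k ∈ Finset.range (c + 1 - (v : ℕ)), f (if k = 0 then 0 else 1) := by
  match v with
  | 0 =>
    let g : Fin (c + 1) → {e : DihEdge c // e.rng = 0} := fun k => ⟨Sum.inl k, rfl⟩
    have hg : Function.Bijective g := by
      refine ⟨fun k l h => Sum.inl.inj (congrArg Subtype.val h), ?_⟩
      rintro ⟨k | k, hk⟩
      · exact ⟨k, rfl⟩
      · exact absurd hk (by simp [rng])
    rw [← (Equiv.ofBijective g hg).sum_comp]
    exact Fin.sum_univ_eq_sum_range (fun k => f (if k = 0 then 0 else 1)) (c + 1)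
  | 1 =>
    let g : Fin c → {e : DihEdge c // e.rng = 1} := fun k => ⟨Sum.inr k, rfl⟩
    have hg : Function.Bijective g := by
      refine ⟨fun k l h => Sum.inr.inj (congrArg Subtype.val h), ?_⟩
      rintro ⟨k | k, hk⟩
      · exact absurd hk (by simp [rng])
      · exact ⟨k, rfl⟩
    rw [← (Equiv.ofBijective g hg).sum_comp]
    exact Fin.sum_univ_eq_sum_range (fun k => f (if k = 0 then 0 else 1)) c

section Position

variable {c : ℕ → ℕ+}

/-- The number of vertices of the tile `𝒯_{v,n}`. -/
noncomputable def tileSize (c : ℕ → ℕ+) (n : ℕ) (v : Fin 2) : ℕ :=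
  Nat.card ((dihDiagram c).Path n v)

/-- The number of vertices in the lowest `k` copies of tiles of level `n` in a tower. -/
noncomputable def towerOffset (c : ℕ → ℕ+) (n k : ℕ) : ℕ :=
  ∑ j ∈ Finset.range k, tileSize c n (if j = 0 then 0 else 1)

theorem towerOffset_succ (c : ℕ → ℕ+) (n k : ℕ) : towerOffset c n (k + 1) =
    towerOffset c n k + tileSize c n (if k = 0 then 0 else 1) :=
  Finset.sum_range_succ _ _

theorem towerOffset_idx_succ (n : ℕ) (e : DihEdge (c n)) : towerOffset c n (e.idx + 1) =
    towerOffset c n e.idx + tileSize c n e.src :=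
  towerOffset_succ _ _ _

theorem towerOffset_mono (c : ℕ → ℕ+) (n : ℕ) : Monotone (towerOffset c n) :=
  monotone_nat_of_le_succ fun k => by rw [towerOffset_succ]; omega

theorem towerOffset_add_one (c : ℕ → ℕ+) (n k : ℕ) :
    towerOffset c n (k + 1) = tileSize c n 0 + k * tileSize c n 1 := by
  induction k with
  | zero => simp [towerOffset]
  | succ k ih => rw [towerOffset_succ, ih, if_neg (by omega)]; ring

theorem tileSize_zero (c : ℕ → ℕ+) (v : Fin 2) : tileSize c 0 v = 1 :=
  Nat.card_unique (α := Unit)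

theorem tileSize_succ (c : ℕ → ℕ+) (n : ℕ) (v : Fin 2) :
    tileSize c (n + 1) v = towerOffset c n (c n + 1 - (v : ℕ)) := by
  classical
  let i (v : Fin 2) : Fintype {e : DihEdge (c n) // e.rng = v} := Fintype.ofFinite _
  rw [towerOffset, ← DihEdge.sum_rng_eq]
  have (e : {e : DihEdge (c n) // e.rng = v}) : Finite ((dihDiagram c).Path n e.1.src) :=
    BratteliDiagram.finite_path _ _ _
  exact Nat.card_sigma (α := {e : DihEdge (c n) // e.rng = v})
    (β := fun e => (dihDiagram c).Path n e.1.src)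

theorem tileSize_succ_zero (c : ℕ → ℕ+) (n : ℕ) :
    tileSize c (n + 1) 0 = tileSize c n 0 + c n * tileSize c n 1 := by
  rw [tileSize_succ, ← towerOffset_add_one]
  rfl

theorem tileSize_succ_one (c : ℕ → ℕ+) (n : ℕ) :
    tileSize c (n + 1) 0 = tileSize c (n + 1) 1 + tileSize c n 1 := by
  have hc := (c n).pos
  obtain ⟨k, hk⟩ : ∃ k, (c n : ℕ) = k + 1 := ⟨c n - 1, by omega⟩
  rw [tileSize_succ_zero, tileSize_succ, hk]
  change _ = towerOffset c n (k + 1) + _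
  rw [towerOffset_add_one]
  ring

/-- The two towers over a level differ by one copy of the tile of `1`, and that copy is no larger
than the shorter tower. -/
theorem tileSize_bounds (c : ℕ → ℕ+) (n : ℕ) :
    0 < tileSize c n 1 ∧ tileSize c n 1 ≤ tileSize c n 0 ∧
      tileSize c n 0 ≤ 2 * tileSize c n 1 := by
  induction n with
  | zero => simp [tileSize_zero]
  | succ n ih =>
    have h1 := tileSize_succ_zero c n
    have h2 := tileSize_succ_one c n
    have h3 : tileSize c n 1 ≤ c n * tileSize c n 1 := Nat.le_mul_of_pos_left _ (c n).pos
    omega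

theorem towerOffset_idx_add_le {n : ℕ} (e : DihEdge (c n)) :
    towerOffset c n e.idx + tileSize c n e.src ≤ tileSize c (n + 1) e.rng := by
  rw [tileSize_succ, ← towerOffset_idx_succ]
  have := e.idx_add_rng_le
  exact towerOffset_mono c n (by omega)

theorem tileSize_of_isTop {n : ℕ} {e : DihEdge (c n)} (h : e.IsTop) :
    tileSize c (n + 1) e.rng = towerOffset c n e.idx + tileSize c n e.src := by
  rw [DihEdge.isTop_iff] at h
  rw [← towerOffset_idx_succ, tileSize_succ]
  congr 1
  omega

/-- The position of a vertex in its tile, counted from the end whose boundary edge has the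
section `a`. -/
noncomputable def tilePos (c : ℕ → ℕ+) :
    (n : ℕ) → (v : (dihDiagram c).V n) → (dihDiagram c).Path n v → ℕ
  | 0, _, _ => 0
  | n + 1, _, x => towerOffset c n (DihEdge.idx (c := c n) x.1.1) +
      if DihEdge.idx (c := c n) x.1.1 % 2 = 1 then tilePos c n _ x.2
      else tileSize c n (DihEdge.src (c := c n) x.1.1) - 1 - tilePos c n _ x.2

theorem tilePos_succ {n : ℕ} {v : (dihDiagram c).V (n + 1)} {e : DihEdge (c n)} (he : e.rng = v)
    (γ : (dihDiagram c).Path n e.src) : tilePos c (n + 1) v ⟨⟨e, he⟩, γ⟩ =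
      towerOffset c n e.idx + if e.idx % 2 = 1 then tilePos c n _ γ
        else tileSize c n e.src - 1 - tilePos c n _ γ :=
  rfl

theorem tilePos_lt : ∀ {n : ℕ} {v : (dihDiagram c).V n} (γ : (dihDiagram c).Path n v),
    tilePos c n v γ < tileSize c n v
  | 0, v, _ => Nat.one_pos.trans_eq (tileSize_zero c v).symm
  | n + 1, v, ⟨⟨e, he⟩, γ⟩ => by
    have h1 := tilePos_lt (n := n) (v := DihEdge.src (c := c n) e) γ
    have h2 := towerOffset_idx_add_le (c := c) e
    rw [show DihEdge.rng (c := c n) e = v from he] at h2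
    refine lt_of_eq_of_lt (tilePos_succ he γ) ?_
    split_ifs <;> omega

/-- Copies of even index are reversed. Thus the `b`-end of the bottom copy comes first and becomes
the new `a`-end, and the free end of the top copy comes last and becomes the new `b`-end. -/
theorem tilePos_of_dihSection : ∀ {n : ℕ} {v : (dihDiagram c).V n} {F t : DihLabel}
    {γ : (dihDiagram c).Path n v}, dihSection c F n v γ = some t →
    tilePos c n v γ = match t with
      | .a => 0
      | .b => tileSize c n v - 1
  | 0, v, _, .a, _, _ => rfl
  | 0, v, _, .b, _, _ => by
    have : tileSize c 0 v = 1 := tileSize_zero c v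
    change 0 = tileSize c 0 v - 1
    omega
  | n + 1, _, F, t, ⟨⟨e, rfl⟩, γ⟩, h => by
    obtain ⟨s, hs, h⟩ := dihSection_succ_eq_some.1 h
    have ih := tilePos_of_dihSection (n := n) (v := DihEdge.src (c := c n) e) hs
    have h1 := tilePos_lt (n := n) (v := DihEdge.src (c := c n) e) γ
    refine (tilePos_succ rfl γ).trans ?_
    cases t with
    | a =>
      obtain ⟨rfl, h0⟩ := DihLabel.next_eq_some_a.1 h
      replace h0 : DihEdge.idx (c := c n) e = 0 := h0
      rw [ih, h0]
      simp [towerOffset]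
    | b =>
      obtain ⟨ht, rfl⟩ := DihLabel.next_eq_some_b.1 h
      have h2 := tileSize_of_isTop (c := c) (e := e) ht
      change _ = tileSize c (n + 1) (DihEdge.rng (c := c n) e) - 1
      rw [ih, h2]
      dsimp only
      by_cases hk : DihEdge.idx (c := c n) e % 2 = 1
      · simp only [hk, if_true]
        omega
      · simp only [hk, if_false]
        omega

/-- The alternating orientation makes connectors join consecutive positions: for even `k` the
`a`-ends of the copies `k` and `k + 1` face each other, for odd `k` the `b`-ends. -/
theorem tilePos_of_swaps {n : ℕ} {v : (dihDiagram c).V (n + 1)} {F t : DihLabel}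
    {e e' : DihEdge (c n)} {he : e.rng = v} {he' : e'.rng = v}
    {γ : (dihDiagram c).Path n e.src} {γ' : (dihDiagram c).Path n e'.src}
    {k : ℕ} (hk : match t with | .a => Even k | .b => Odd k)
    (h : dihSection c F n _ γ = some t) (h' : dihSection c F n _ γ' = some t) (hi : e.idx = k) (hi' : e'.idx = k + 1) :
    tilePos c (n + 1) v ⟨⟨e', he'⟩, γ'⟩ = tilePos c (n + 1) v ⟨⟨e, he⟩, γ⟩ + 1 := by
  have h1 := tilePos_of_dihSection h
  have h1' := tilePos_of_dihSection h'
  have h2 := tilePos_lt γ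
  have h2' := tilePos_lt γ'
  have h3 := towerOffset_idx_succ (c := c) n e
  rw [tilePos_succ, tilePos_succ, hi', ← hi, h3]
  cases t with
  | a =>
    rw [Nat.even_iff, ← hi] at hk
    dsimp only at h1 h1'
    rw [if_pos (by omega), if_neg (by omega)]
    omega
  | b =>
    rw [Nat.odd_iff, ← hi] at hk
    dsimp only at h1 h1'
    rw [if_neg (by omega), if_pos (by omega)]
    omega

theorem tilePos_of_edge : ∀ {n : ℕ} {v : (dihDiagram c).V n} {F : DihLabel}
    {x y : (dihDiagram c).Path n v}, (dihInflation c).Edge n v F x y →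
    tilePos c n v y ≤ tilePos c n v x + 1 ∧ tilePos c n v x ≤ tilePos c n v y + 1
  | 0, _, _, _, _, h => h.elim
  | n + 1, v, F, ⟨⟨e, he⟩, γ⟩, ⟨⟨e', he'⟩, γ'⟩, Or.inl ⟨t, hx, hy, k, hk, Or.inl h⟩ => by
    have := tilePos_of_swaps (c := c) (he := he) (he' := he') hk hx hy h.1 h.2
    exact ⟨this.le, (Nat.le_succ _).trans (this.ge.trans (Nat.le_succ _))⟩
  | n + 1, v, F, ⟨⟨e, he⟩, γ⟩, ⟨⟨e', he'⟩, γ'⟩, Or.inl ⟨t, hx, hy, k, hk, Or.inr h⟩ => by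
    have := tilePos_of_swaps (c := c) (he := he') (he' := he) hk hy hx h.1 h.2
    exact ⟨(Nat.le_succ _).trans (this.ge.trans (Nat.le_succ _)), this.le⟩
  | n + 1, v, F, x, y, Or.inr ⟨⟨e, he⟩, γ, γ', hx, hy, hE⟩ => by
    subst hx hy
    have h : tilePos c n (DihEdge.src (c := c n) e) γ' ≤ tilePos c n (DihEdge.src (c := c n) e) γ + 1 ∧
        tilePos c n (DihEdge.src (c := c n) e) γ ≤ tilePos c n (DihEdge.src (c := c n) e) γ' + 1 := tilePos_of_edge hE
    have h1 := tilePos_lt (n := n) (v := DihEdge.src (c := c n) e) γ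
    have h2 := tilePos_lt (n := n) (v := DihEdge.src (c := c n) e) γ'
    rw [show tilePos c (n + 1) v ⟨⟨e, he⟩, γ⟩ = _ from tilePos_succ he γ,
      show tilePos c (n + 1) v ⟨⟨e, he⟩, γ'⟩ = _ from tilePos_succ he γ']
    split_ifs <;> omega

end Position

/-! ### Two distance estimates in graphs -/

theorem SimpleGraph.Reachable.le_add_dist {V : Type*} {G : SimpleGraph V} {f : V → ℕ}
    (hf : ∀ x y, G.Adj x y → f x ≤ f y + 1) {x y : V} (h : G.Reachable x y) :
    f x ≤ f y + G.dist x y := by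
  obtain ⟨p, hp⟩ := h.exists_walk_length_eq_dist
  rw [← hp]
  clear hp h
  induction p with
  | nil => simp
  | cons h p ih =>
    have := hf _ _ h
    rw [SimpleGraph.Walk.length_cons]
    omega

theorem SimpleGraph.Connected.dist_lt_card {V : Type*} [Finite V] {G : SimpleGraph V}
    (h : G.Connected) (x y : V) : G.dist x y < Nat.card V := by
  have := Fintype.ofFinite V
  obtain ⟨p, hp, hl⟩ := h.exists_path_of_dist x y
  rw [← hl, Nat.card_eq_fintype_card]
  exact hp.length_lt

/-! ### Diameters of the tiles -/

section Diameter

variable {c : ℕ → ℕ+}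

/-- A connected graph has diameter below its number of vertices. Equality holds because the position
is 1-Lipschitz and takes the values 0 and size minus 1 at the two ends. -/
theorem diam_tileGraph_add_one (n : ℕ) (v : (dihDiagram c).V n) :
    ((dihInflation c).tileGraph n v).diam + 1 = tileSize c n v := by
  have hconn := tileGraph_connected (c := c) n v
  have : Nonempty ((dihDiagram c).Path n v) := hconn.nonempty
  refine le_antisymm ?_ ?_
  · obtain ⟨x, y, h⟩ := ((dihInflation c).tileGraph n v).exists_dist_eq_diam
    rw [← h]
    exact hconn.dist_lt_card x y
  · obtain ⟨F, γ, h⟩ := exists_dihSection_eq (c := c) n v DihLabel.a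
    obtain ⟨F', γ', h'⟩ := exists_dihSection_eq (c := c) n v DihLabel.b
    have h1 := tilePos_of_dihSection h
    have h2 := tilePos_of_dihSection h'
    have h3 := tilePos_lt γ'
    have h4 := (hconn.preconnected γ' γ).le_add_dist (f := tilePos c n v) (by
      intro x y hxy
      rcases ((SimpleGraph.fromRel_adj _ _ _).1 hxy).2 with ⟨F, hF⟩ | ⟨F, hF⟩
      · exact (tilePos_of_edge hF).2
      · exact (tilePos_of_edge hF).1)
    have h5 := SimpleGraph.dist_le_diam (SimpleGraph.connected_iff_ediam_ne_top.1 hconn)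
      (u := γ') (v := γ)
    dsimp only at h1 h2
    omega

end Diameter

/-! ### Paths with a given tail -/

namespace BratteliDiagram

variable {B : BratteliDiagram}

/-- The sequence of edges `f` with its initial part replaced by the edges of a finite path. -/
def glueEdges (B : BratteliDiagram) :
    (n : ℕ) → (v : B.V n) → B.Path n v → ((m : ℕ) → B.E m) → (m : ℕ) → B.E m
  | 0, _, _, f => f
  | n + 1, _, x, f => glueEdges B n _ x.2 (Function.update f n x.1.1)

theorem glueEdges_of_le : ∀ {n : ℕ} {v : B.V n} (x : B.Path n v) (f : (m : ℕ) → B.E m) {m : ℕ},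
    n ≤ m → B.glueEdges n v x f m = f m
  | 0, _, _, _, _, _ => rfl
  | n + 1, _, x, f, m, h => by
    rw [glueEdges, glueEdges_of_le _ _ (by omega), Function.update_of_ne (by omega)]

/-- Compatibility of `f` is assumed only from `n` on, since the update made in the recursion may
destroy it below. -/
theorem glueEdges_compat : ∀ {n : ℕ} {v : B.V n} (x : B.Path n v) (f : (m : ℕ) → B.E m),
    B.src n (f n) = v → (∀ m, n ≤ m → B.rng m (f m) = B.src (m + 1) (f (m + 1))) →
    ∀ m, B.rng m (B.glueEdges n v x f m) = B.src (m + 1) (B.glueEdges n v x f (m + 1))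
  | 0, _, _, _, _, h, m => h m (by omega)
  | n + 1, v, x, f, hv, h, m => by
    refine glueEdges_compat (n := n) x.2 _ (by rw [Function.update_self]) (fun k hk => ?_) m
    rw [Function.update_of_ne (a := k + 1) (by omega)]
    rcases hk.eq_or_lt with rfl | hk
    · rw [Function.update_self, x.1.2, hv]
    · rw [Function.update_of_ne (by omega), h k hk]

/-- The infinite path that begins with the finite path `x` and has the tail of `ω`. -/
def glue {n : ℕ} {v : B.V n} (x : B.Path n v) (ω : B.Omega) (h : B.src n (ω.edge n) = v) :
    B.Omega where
  edge := B.glueEdges n v x ω.edge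
  compat := glueEdges_compat x ω.edge h fun m _ => ω.compat m

/-- The point `η` is kept separate because the recursion changes `x` and `f` but not the glued
sequence. -/
theorem trunc_of_edge_eq : ∀ {n : ℕ} {v : B.V n} {x : B.Path n v} {f : (m : ℕ) → B.E m}
    {η : B.Omega} (_ : η.edge = B.glueEdges n v x f) (h : B.src n (η.edge n) = v),
    B.trunc η n v h = x
  | 0, _, _, _, _, _, _ => rfl
  | n + 1, v, ⟨e, γ⟩, f, η, hη, h => by
    replace hη : η.edge = B.glueEdges n _ γ (Function.update f n e.1) := hη
    have he : η.edge n = e.1 := by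
      rw [hη, glueEdges_of_le _ _ le_rfl, Function.update_self]
    rw [trunc_succ_of_edge_eq he h, trunc_of_edge_eq (x := γ) hη]

variable {n : ℕ} {v : B.V n}

theorem glue_edge_of_le (x : B.Path n v) (ω : B.Omega) (h : B.src n (ω.edge n) = v) {m : ℕ}
    (hm : n ≤ m) : (glue x ω h).edge m = ω.edge m :=
  glueEdges_of_le x ω.edge hm

theorem src_glue (x : B.Path n v) (ω : B.Omega) (h : B.src n (ω.edge n) = v) :
    B.src n ((glue x ω h).edge n) = v := by
  rw [glue_edge_of_le x ω h le_rfl, h]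

theorem trunc_glue (x : B.Path n v) (ω : B.Omega) (h : B.src n (ω.edge n) = v) :
    B.trunc (glue x ω h) n v (src_glue x ω h) = x :=
  trunc_of_edge_eq rfl _

theorem glue_trunc {ω η : B.Omega} (h : B.src n (ω.edge n) = v) (h' : B.src n (η.edge n) = v)
    (ht : ∀ m, n ≤ m → η.edge m = ω.edge m) : glue (B.trunc η n v h') ω h = η := by
  refine Omega.ext (funext fun m => ?_)
  rcases lt_or_ge m n with hm | hm
  · exact edge_eq_of_trunc_eq (trunc_glue (B.trunc η n v h') ω h) m hm
  · rw [glue_edge_of_le _ _ _ hm, ht m hm]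

end BratteliDiagram

open BratteliDiagram

/-! ### Copies of finite tiles in infinite tiles -/

namespace InflationData

variable {B : BratteliDiagram} {S : Type}

/-- The copy of a tile with a given tail. -/
def copyHom (R : InflationData B S) {n : ℕ} {v : B.V n} (ω : B.Omega)
    (h : B.src n (ω.edge n) = v) : R.tileGraph n v →g R.infTileGraph where
  toFun x := glue x ω h
  map_rel' := by
    intro x y hxy
    have key : ∀ {x y : B.Path n v} {F : S}, R.Edge n v F x y →
        R.InfEdge F (glue x ω h) (glue y ω h) := fun {x y F} hF =>
      ⟨n, v, src_glue x ω h, src_glue y ω h,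
        fun m hm => by rw [glue_edge_of_le _ _ _ hm, glue_edge_of_le _ _ _ hm],
        by rw [trunc_glue, trunc_glue]; exact hF⟩
    obtain ⟨hne, hE⟩ := (SimpleGraph.fromRel_adj _ _ _).1 hxy
    refine (SimpleGraph.fromRel_adj _ _ _).2 ⟨fun he => hne ?_, ?_⟩
    · have h1 := trunc_glue x ω h
      have h2 := trunc_glue y ω h
      rw [← h1, ← h2]
      congr 1
    · exact hE.imp (fun ⟨F, hF⟩ => ⟨F, key hF⟩) (fun ⟨F, hF⟩ => ⟨F, key hF⟩)

theorem infTileGraph_dist_lt {R : InflationData B S} {n : ℕ} {v : B.V n}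
    (hR : (R.tileGraph n v).Connected) {ω η : B.Omega} (h : B.src n (ω.edge n) = v)
    (ht : ∀ m, n ≤ m → η.edge m = ω.edge m) :
    R.infTileGraph.Reachable ω η ∧ R.infTileGraph.dist ω η < Nat.card (B.Path n v) := by
  have h' : B.src n (η.edge n) = v := by rw [ht n le_rfl, h]
  obtain ⟨p, hp⟩ := hR.exists_walk_length_eq_dist (B.trunc ω n v h) (B.trunc η n v h')
  have h1 : R.copyHom ω h (B.trunc ω n v h) = ω := glue_trunc h h fun _ _ => rfl
  have h2 : R.copyHom ω h (B.trunc η n v h') = η := glue_trunc h h' ht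
  let q : R.infTileGraph.Walk ω η := (p.map (R.copyHom ω h)).copy h1 h2
  refine ⟨⟨q⟩, (SimpleGraph.dist_le q).trans_lt ?_⟩
  rw [SimpleGraph.Walk.length_copy, SimpleGraph.Walk.length_map, hp]
  exact hR.dist_lt_card _ _

end InflationData

/-! ### Linear repetitivity -/

section LinearRepetitivity

variable {c : ℕ → ℕ+}

/-- In the factor, `M` accounts for the copies of the tile of `1`, and 2 for the bottom copy. -/
theorem tileSize_succ_le {M : ℕ} (hM : ∀ n, (c n : ℕ) ≤ M) (n : ℕ) (v : Fin 2) :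
    tileSize c (n + 1) v ≤ (M + 2) * tileSize c n 1 := by
  have h1 := tileSize_succ_zero c n
  have h2 := tileSize_bounds c (n + 1)
  have h3 := tileSize_bounds c n
  have h4 : c n * tileSize c n 1 ≤ M * tileSize c n 1 := Nat.mul_le_mul_right _ (hM n)
  have h5 : (M + 2) * tileSize c n 1 = M * tileSize c n 1 + 2 * tileSize c n 1 := by ring
  have h6 : tileSize c (n + 1) v ≤ tileSize c (n + 1) 0 := by
    match v with
    | 0 => exact le_rfl
    | 1 => exact h2.2.1
  omega

theorem tileSize_add_two_le {M : ℕ} (hM : ∀ n, (c n : ℕ) ≤ M) (n : ℕ) (v w : Fin 2) :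
    tileSize c (n + 2) v ≤ (M + 2) ^ 2 * tileSize c n w := by
  have h1 := tileSize_succ_le hM (n + 1) v
  have h2 := tileSize_succ_le hM n 1
  have h3 : tileSize c n 1 ≤ tileSize c n w := by
    match w with
    | 0 => exact (tileSize_bounds c n).2.1
    | 1 => exact le_rfl
  calc tileSize c (n + 2) v ≤ (M + 2) * ((M + 2) * tileSize c n w) :=
        h1.trans (Nat.mul_le_mul_left _ (h2.trans (Nat.mul_le_mul_left _ h3)))
    _ = _ := by ring

theorem one_lt_tileSize_iff (n : ℕ) (v : Fin 2) :
    1 < tileSize c n v ↔ Nontrivial ((dihDiagram c).Path n v) :=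
  have : Finite ((dihDiagram c).Path n v) := finite_path _ _ _
  Finite.one_lt_card_iff_nontrivial

theorem linearlyRepetitiveOn_infTileGraph {M : ℕ} (hM : ∀ n, (c n : ℕ) ≤ M) :
    (dihInflation c).LinearlyRepetitiveOn (dihInflation c).infTileGraph := by
  have hM0 : (0 : ℝ) ≤ M := M.cast_nonneg
  -- The factor 2 passes from size to diameter: a size `s > 1` satisfies `s ≤ 2 * (s - 1)`.
  refine ⟨2 * ((M : ℝ) + 2) ^ 2, by nlinarith, fun n (v : Fin 2) hnt ω => ?_⟩
  have hcn := (c n).pos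
  let w : Fin 2 := DihEdge.src (c := c (n + 2)) (ω.edge (n + 2))
  -- Inside the tile of level `n + 2` around `ω`, the bottom copy is a tile of the vertex `0` of
  -- level `n + 1`; its copies of index 0 and 1 are tiles of the vertices `0` and `1` of level `n`.
  -- Hence the index `k = v`.
  obtain ⟨e₀, hi₀, hr₀⟩ := DihEdge.exists_idx_rng (c := c n) 0 (k := v) (by
    have := v.2
    change (v : ℕ) + 0 ≤ _
    omega)
  obtain ⟨e₁, hi₁, hr₁⟩ := DihEdge.exists_idx_rng (c := c (n + 1)) w (k := 0) (by
    have := w.2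
    have := (c (n + 1)).pos
    omega)
  have hs₀ : e₀.src = v := by
    unfold DihEdge.src
    rw [hi₀]
    match v with
    | 0 => rfl
    | 1 => rfl
  obtain ⟨-, γ, -⟩ := exists_dihSection_eq (c := c) n e₀.src DihLabel.a
  let x : (dihDiagram c).Path (n + 2) w :=
    ⟨⟨e₁, hr₁⟩, ⟨⟨e₀, hr₀.trans (DihEdge.src_eq_zero_iff.2 hi₁).symm⟩, γ⟩⟩
  refine ⟨glue x ω rfl, ?_, fun ζ hζ => ?_⟩
  · have : (glue x ω rfl).edge n = e₀ :=
      (glueEdges_of_le (B := dihDiagram c) γ _ le_rfl).trans (Function.update_self _ _ _)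
    rw [this]
    exact hs₀
  · obtain ⟨h1, h2⟩ := InflationData.infTileGraph_dist_lt (n := n + 2) (ω := ω) (η := ζ)
      (tileGraph_connected (c := c) (n + 2) w) rfl fun m hm =>
        (hζ m (by omega)).trans (glue_edge_of_le x ω rfl hm)
    refine ⟨h1, ?_⟩
    have h3 := tileSize_add_two_le hM n w v
    have h4 : ((dihInflation c).infTileGraph.dist ω ζ : ℝ) ≤ (M + 2) ^ 2 * tileSize c n v := by
      exact_mod_cast h2.le.trans h3
    have h5 : ((dihInflation c).tileGraph n v).diam + 1 = tileSize c n v :=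
      diam_tileGraph_add_one n v
    have h6 := (one_lt_tileSize_iff n v).2 hnt
    have h7 : (tileSize c n v : ℝ) ≤ 2 * ((dihInflation c).tileGraph n v).diam := by
      exact_mod_cast (by omega : tileSize c n v ≤ 2 * ((dihInflation c).tileGraph n v).diam)
    calc _ ≤ _ := h4
      _ ≤ ((M : ℝ) + 2) ^ 2 * (2 * ((dihInflation c).tileGraph n v).diam) := by gcongr
      _ = _ := by ring

theorem infTileGraph_le_orbitalGraph (c : ℕ → ℕ+) :
    (dihInflation c).infTileGraph ≤ orbitalGraph (dihAct c) := by
  intro ω ω' h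
  obtain ⟨hne, hE⟩ := (SimpleGraph.fromRel_adj _ _ _).1 h
  have key := (dihInflation_extendsTo c).2.2.1
  exact (SimpleGraph.fromRel_adj _ _ _).2 ⟨hne,
    hE.imp (fun ⟨F, hF⟩ => ⟨F, key _ _ _ hF⟩) (fun ⟨F, hF⟩ => ⟨F, key _ _ _ hF⟩)⟩

theorem InflationData.LinearlyRepetitiveOn.mono {B : BratteliDiagram} {S : Type}
    {R : InflationData B S} {G G' : SimpleGraph B.Omega} (hG : G ≤ G')
    (h : R.LinearlyRepetitiveOn G) : R.LinearlyRepetitiveOn G' := by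
  obtain ⟨K, hK, h⟩ := h
  refine ⟨K, hK, fun n v hnt ω => ?_⟩
  obtain ⟨ζ, hv, hζ⟩ := h n v hnt ω
  refine ⟨ζ, hv, fun ζ' h' => ?_⟩
  obtain ⟨h1, h2⟩ := hζ ζ' h'
  -- Distances shrink in a larger graph only between points reachable in the smaller one, as `dist`
  -- is 0 by default.
  exact ⟨h1.mono hG, le_trans (by exact_mod_cast h1.dist_anti hG) h2⟩

/-- The distance of a point from the ends of its tile of level `n`. -/
noncomputable def endDist (c : ℕ → ℕ+) (n : ℕ) (ω : (dihDiagram c).Omega) : ℕ :=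
  min (tilePos c n _ ((dihDiagram c).trunc ω n _ rfl))
    (tileSize c n (DihEdge.src (c := c n) (ω.edge n)) - 1 -
      tilePos c n _ ((dihDiagram c).trunc ω n _ rfl))

theorem endDist_eq {n : ℕ} {v : (dihDiagram c).V n} {ω : (dihDiagram c).Omega}
    (h : (dihDiagram c).src n (ω.edge n) = v) :
    endDist c n ω = min (tilePos c n v ((dihDiagram c).trunc ω n v h))
      (tileSize c n v - 1 - tilePos c n v ((dihDiagram c).trunc ω n v h)) := by
  subst h
  rfl

theorem endDist_of_dihState {F t : DihLabel} {n : ℕ} {ω : (dihDiagram c).Omega}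
    (h : dihState F ω.edge n = some t) : endDist c n ω = 0 := by
  have h1 := tilePos_of_dihSection ((dihState_eq_dihSection F ω n _ rfl).trans h)
  rw [endDist_eq rfl, h1]
  cases t <;> simp

/-- Either the section dies within the first `n` edges and the point moves to a neighbour in the
same tile, or the point and its image are both ends of their tiles and the value is 0 at both. So
leaving a tile of level `n` costs nothing, even through the extra edges of orbital graphs. -/
theorem endDist_dihMap (F : DihLabel) (n : ℕ) (ω : (dihDiagram c).Omega) :
    endDist c n ω ≤ endDist c n (dihMap c F ω) + 1 ∧
      endDist c n (dihMap c F ω) ≤ endDist c n ω + 1 := by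
  cases h : dihState F ω.edge n with
  | none =>
    have he : (dihMap c F ω).edge n = ω.edge n := dihImage_eq_of_eq_none ω.compat h
    have hE := tilePos_of_edge (edge_trunc_dihMap h _ rfl (congrArg _ he))
    rw [endDist_eq rfl, endDist_eq (ω := dihMap c F ω) (congrArg _ he)]
    omega
  | some t =>
    have h' := (dihState_dihImage F ω.edge ω.compat n).trans h
    rw [endDist_of_dihState h, endDist_of_dihState (ω := dihMap c F ω) h']
    omega

theorem endDist_of_adj (n : ℕ) (ω ω' : (dihDiagram c).Omega)
    (h : (orbitalGraph (dihAct c)).Adj ω ω') : endDist c n ω ≤ endDist c n ω' + 1 := by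
  obtain ⟨-, ⟨F, rfl⟩ | ⟨F, rfl⟩⟩ := (SimpleGraph.fromRel_adj _ _ _).1 h
  · exact (endDist_dihMap F n ω).1
  · exact (endDist_dihMap F n ω').2

/-- An edge with source `0` has index 0, so the point lies in the bottom copy of its tower. -/
theorem endDist_lt_of_src_eq_zero {n : ℕ} {ζ : (dihDiagram c).Omega}
    (h : (dihDiagram c).src n (ζ.edge n) = (0 : Fin 2)) :
    endDist c (n + 1) ζ < tileSize c n 0 := by
  have hi : DihEdge.idx (c := c n) (ζ.edge n) = 0 := DihEdge.src_eq_zero_iff.1 h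
  refine (min_le_left _ _).trans_lt ?_
  have h1 := tilePos_lt ((dihDiagram c).trunc ζ n (0 : Fin 2) h)
  refine lt_of_eq_of_lt (congrArg (tilePos c (n + 1) _) (trunc_succ_of_edge_eq rfl rfl)) ?_
  refine lt_of_eq_of_lt (tilePos_succ (c := c) (e := ζ.edge n) _ _) ?_
  have h2 := tilePos_lt ((dihDiagram c).trunc ζ n _ rfl)
  have h3 : tileSize c n ((dihDiagram c).src n (ζ.edge n)) = tileSize c n 0 := by rw [h]
  have h4 : tileSize c n (DihEdge.src (c := c n) (ζ.edge n)) = tileSize c n 0 := h3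
  rw [hi, h4]
  simp only [towerOffset, Finset.range_zero, Finset.sum_empty, Nat.zero_mod, zero_ne_one,
    if_false]
  omega

/-- Some points lie in the middle of the tower of `cₙ` copies of the tile `𝒯_{1,n}`. -/
theorem exists_le_endDist (c : ℕ → ℕ+) (n : ℕ) (hc : 2 ≤ (c n : ℕ)) :
    ∃ ω, (c n / 2) * tileSize c n 1 ≤ endDist c (n + 1) ω + tileSize c n 1 := by
  -- Only the tail of this point is used; any tail starting in the vertex `0` would serve.
  let ω₀ : (dihDiagram c).Omega :=
    { edge := fun m => Sum.inl ⟨0, Nat.succ_pos _⟩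
      compat := fun m => rfl }
  obtain ⟨-, γ, -⟩ := exists_dihSection_eq (c := c) n (1 : Fin 2) DihLabel.a
  obtain ⟨j, hj⟩ : ∃ j, j = (c n : ℕ) / 2 := ⟨_, rfl⟩
  -- Below this copy lie the bottom copy and `j` copies of the tile of `1`; above it lie at least `j
  -- - 1` of them, hence the extra summand `tileSize c n 1` in the estimate.
  let e : DihEdge (c n) := Sum.inl ⟨j + 1, by omega⟩
  let x : (dihDiagram c).Path (n + 1) (0 : Fin 2) := ⟨⟨e, rfl⟩, γ⟩
  refine ⟨glue x ω₀ rfl, ?_⟩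
  have h0 : (dihDiagram c).trunc (glue x ω₀ rfl) (n + 1) (0 : Fin 2) (src_glue x ω₀ rfl) = x :=
    trunc_glue x ω₀ rfl
  rw [endDist_eq (src_glue x ω₀ rfl), h0]
  have h1 := tilePos_lt γ
  have h2 : tilePos c (n + 1) (0 : Fin 2) x = towerOffset c n (j + 1) +
      if (j + 1) % 2 = 1 then tilePos c n (1 : Fin 2) γ
      else tileSize c n 1 - 1 - tilePos c n (1 : Fin 2) γ := tilePos_succ (e := e) rfl γ
  have h3 := towerOffset_add_one c n j
  have h4 := tileSize_succ_zero c n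
  have h5 : (j + j) * tileSize c n 1 ≤ c n * tileSize c n 1 :=
    Nat.mul_le_mul_right _ (by omega)
  rw [add_mul] at h5
  rw [← hj]
  have h6 : tileSize c (n + 1) (0 : Fin 2) - 1 - tilePos c (n + 1) (0 : Fin 2) x +
      tileSize c n 1 ≥ j * tileSize c n 1 := by
    split_ifs at h2 <;> omega
  have h7 : tilePos c (n + 1) (0 : Fin 2) x ≥ j * tileSize c n 1 := by omega
  rw [min_def]
  split_ifs
  · omega
  · exact h6

theorem bounded_of_linearlyRepetitiveOn
    (h : (dihInflation c).LinearlyRepetitiveOn (orbitalGraph (dihAct c))) :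
    ∃ M : ℕ, ∀ n, (c n : ℕ) ≤ M := by
  obtain ⟨K, hK, h⟩ := h
  obtain ⟨L, hL⟩ := exists_nat_ge K
  -- Tiles of level 0 are single vertices, to which repetitivity does not apply, so `c 0` is added
  -- by hand. For `n > 0` and `2 ≤ c n` the estimate is `c n / 2 ≤ 2 * L + 3` with rounded division:
  -- `2 * L` from the radius, 2 from the copy of the tile of `0`, and 1 from the loss in
  -- `exists_le_endDist`.
  refine ⟨c 0 + (4 * L + 7), fun n => ?_⟩
  obtain rfl | hn := Nat.eq_zero_or_pos n
  · omega
  by_cases hc : 2 ≤ (c n : ℕ)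
  swap
  · omega
  obtain ⟨ω, hω⟩ := exists_le_endDist c n hc
  have hb := tileSize_bounds c n
  have hnt : 1 < tileSize c n 0 := by
    obtain ⟨k, rfl⟩ : ∃ k, n = k + 1 := ⟨n - 1, by omega⟩
    have h1 := tileSize_succ_one c k
    have h2 := tileSize_bounds c k
    omega
  obtain ⟨ζ, hs, hζ⟩ := h n (0 : Fin 2) ((one_lt_tileSize_iff n 0).1 hnt) ω
  obtain ⟨hr, hd⟩ := hζ ζ fun _ _ => rfl
  have h1 := hr.le_add_dist (endDist_of_adj (n + 1))
  have h2 := endDist_lt_of_src_eq_zero hs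
  have h3 : ((dihInflation c).tileGraph n (0 : Fin 2)).diam + 1 = tileSize c n 0 :=
    diam_tileGraph_add_one n _
  have h4 : (orbitalGraph (dihAct c)).dist ω ζ ≤
      L * ((dihInflation c).tileGraph n (0 : Fin 2)).diam := by
    have := hd.trans (mul_le_mul_of_nonneg_right hL (Nat.cast_nonneg _))
    exact_mod_cast this
  have h5 : L * ((dihInflation c).tileGraph n (0 : Fin 2)).diam ≤ L * (2 * tileSize c n 1) :=
    Nat.mul_le_mul_left _ (by omega)
  have h6 : (c n / 2) * tileSize c n 1 ≤ (2 * L + 3) * tileSize c n 1 := by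
    have : (2 * L + 3) * tileSize c n 1 = L * (2 * tileSize c n 1) + 3 * tileSize c n 1 := by ring
    omega
  have h7 := Nat.le_of_mul_le_mul_right h6 hb.1
  omega

end LinearRepetitivity

/-! ### The three equivalences -/

theorem mainTheorem9 (θ : ℝ) (hθ : Irrational θ) (hθ₀ : 0 < θ) (hθ₁ : θ < 1) (c : ℕ → ℕ+)
    (hc : ∀ n, (GenContFract.of θ).partDens.get? n = some ((c n : ℕ) : ℝ)) :
    ((dihInflation c).LinearlyRepetitiveOn (dihInflation c).infTileGraph ↔
      ∃ M : ℕ, ∀ n, (c n : ℕ) ≤ M) ∧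
    ((dihInflation c).LinearlyRepetitiveOn (orbitalGraph (dihAct c)) ↔
      ∃ M : ℕ, ∀ n, (c n : ℕ) ≤ M) ∧
    ((dihInflation c).IsGroupOfBoundedType (dihAct c) ↔
      ∃ M : ℕ, ∀ n, (c n : ℕ) ≤ M) := by

  have h1 := fun h : ∃ M : ℕ, ∀ n, (c n : ℕ) ≤ M => linearlyRepetitiveOn_infTileGraph h.choose_spec
  have h2 := fun h : (dihInflation c).LinearlyRepetitiveOn (dihInflation c).infTileGraph =>
    h.mono (infTileGraph_le_orbitalGraph c)
  exact ⟨⟨fun h => bounded_of_linearlyRepetitiveOn (h2 h), h1⟩,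
    ⟨bounded_of_linearlyRepetitiveOn, fun h => h2 (h1 h)⟩, isGroupOfBoundedType_iff c⟩
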